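/- **Theorem (Simon and Moustakas).** Let $r\ge 1$ and $t\ge 2$ be integers and let $\gamma>0$. Consider the ergodic channel $y=\sqrt{\gamma}\,Hx+z$ with $t$ inputs and $r$ outputs, where $H=R^{1/2}GT^{1/2}$, the $r\times t$ matrix $G$ has i.i.d. circularly symmetric complex Gaussian entries of unit variance, $R=\operatorname{diag}(\rho_1,\dots,\rho_r)$ and $T=\operatorname{diag}(\tau_1,\dots,\tau_t)$. Assume that $\operatorname{tr}R=r$ and $\operatorname{tr}T=t$, that $\rho_1,\dots,\rho_r$ are positive and pairwise distinct, and that $\tau_k\ge 0$ for all $k$, $\tau_1>0$ and $\tau_2=\max_{k\ge 2}\tau_k$ (for example $\tau_1\ge\tau_2\ge\dots\ge\tau_t\ge 0$). For a positive semidefinite $t\times t$ matrix $Q$ put $$\Psi(Q)=\mathbb E\,\log\det\left(I_r+\gamma HQH^{\dagger}\right).$$ Beamforming is called optimal if $Q=\operatorname{diag}(1,0,\dots,0)$ maximizes $\Psi$ over all positive semidefinite Hermitian $Q$ with $\operatorname{tr}Q\le 1$. Then beamforming is optimal if and only if $$\sum_{i,j=1}^{r}\frac{\rho_i(1+\gamma\tau_2\rho_i)\,\rho_j^{\,r-1}}{\prod_{k\ne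 j}(\rho_j-\rho_k)}\,\zeta_{ij}\;\ge\; r\gamma\tau_2 ,$$ where $$\zeta_{ij}=\begin{cases}\dfrac{f(\gamma\tau_1\rho_i)-f(\gamma\tau_1\rho_j)}{\rho_i-\rho_j}, & i\ne j,\\[2ex] \dfrac1{\rho_i}\left(1-\dfrac{f(\gamma\tau_1\rho_i)}{\gamma\tau_1\rho_i}\right), & i=j,\end{cases}\qquad f(x)=e^{1/x}\,\Gamma(0,1/x),$$ and $\Gamma(a,x)=\int_x^\infty s^{a-1}e^{-s}\,ds$ is the upper incomplete Gamma function. -/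

import Mathlib

open MeasureTheory ProbabilityTheory
open scoped Matrix MatrixOrder ComplexOrder

noncomputable section

namespace MIMO

/-- Complex matrices carry the product (equivalently, Borel) σ-algebra of their entries. -/
instance instMeasurableSpaceMatrix (m n : Type*) : MeasurableSpace (Matrix m n ℂ) :=
  inferInstanceAs (MeasurableSpace (m → n → ℂ))

/-- The circularly symmetric complex Gaussian law of unit variance: the real and imaginary parts
are independent real Gaussians of mean `0` and variance `1/2`. -/
def stdComplexGaussian : Measure ℂ :=
  ((gaussianReal 0 (1 / 2)).prod (gaussianReal 0 (1 / 2))).map fun p => (⟨p.1, p.2⟩ : ℂ)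

/-- The law of an `r × t` matrix with i.i.d. circularly symmetric complex Gaussian entries of
unit variance. -/
def stdGaussianMatrix (r t : ℕ) : Measure (Matrix (Fin r) (Fin t) ℂ) :=
  Measure.pi fun _ : Fin r => Measure.pi fun _ : Fin t => stdComplexGaussian

/-- The zero-mean Kronecker correlated Gaussian law (Rayleigh fading) with receive correlation `R`
and transmit correlation `T`, both positive semidefinite: the law of `R^{1/2} G T^{1/2}`, where
`G` has i.i.d. circularly symmetric complex Gaussian entries of unit variance. -/
def kroneckerRayleigh {r t : ℕ} (R : Matrix (Fin r) (Fin r) ℂ) (T : Matrix (Fin t) (Fin t) ℂ) :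
    Measure (Matrix (Fin r) (Fin t) ℂ) :=
  (stdGaussianMatrix r t).map fun G => CFC.sqrt R * G * CFC.sqrt T

/-- The ergodic information rate `E [log det (I + γ H Q Hᴴ)]` of the channel `y = √γ H x + z`,
for the input covariance `Q`, the channel law `p` and the signal-to-noise ratio `γ`.
For positive semidefinite `Q` and `0 ≤ γ` the determinant is a real number that is at least `1`. -/
def ergodicRate {r t : ℕ} (γ : ℝ) (p : Measure (Matrix (Fin r) (Fin t) ℂ))
    (Q : Matrix (Fin t) (Fin t) ℂ) : ℝ :=
  ∫ H, Real.log (Matrix.det (1 + (γ : ℂ) • (H * Q * Hᴴ))).re ∂p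

/-- The admissible input covariances: positive semidefinite with trace at most one. -/
def feasibleCovariances (t : ℕ) : Set (Matrix (Fin t) (Fin t) ℂ) :=
  {Q | Q.PosSemidef ∧ Q.trace.re ≤ 1}

/-- `Q` is a capacity achieving input covariance. -/
def IsOptimalCovariance {r t : ℕ} (γ : ℝ) (p : Measure (Matrix (Fin r) (Fin t) ℂ))
    (Q : Matrix (Fin t) (Fin t) ℂ) : Prop :=
  Q ∈ feasibleCovariances t ∧ IsMaxOn (ergodicRate γ p) (feasibleCovariances t) Q

/-- The upper incomplete Gamma function `Γ(a, x) = ∫_x^∞ s^{a-1} e^{-s} ds`, for `0 < x`. -/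
def upperIncompleteGamma (a x : ℝ) : ℝ :=
  ∫ s in Set.Ioi x, s ^ (a - 1) * Real.exp (-s)

/-- `f(x) = e^{1/x} Γ(0, 1/x)`, for `0 < x`. -/
def beamF (x : ℝ) : ℝ := Real.exp (1 / x) * upperIncompleteGamma 0 (1 / x)

/-- The coefficients `ζ_ij`, as functions of `a = γ τ₁` and of the receive eigenvalues `ρ`. -/
def beamZeta {r : ℕ} (a : ℝ) (ρ : Fin r → ℝ) (i j : Fin r) : ℝ :=
  if i = j then 1 / ρ i * (1 - beamF (a * ρ i) / (a * ρ i))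
  else (beamF (a * ρ i) - beamF (a * ρ j)) / (ρ i - ρ j)

end MIMO

end

noncomputable section

namespace MIMO

/-! Since `log det` is concave, optimality of the beam is equivalent to a first-order condition
there. Write `h_k` for the columns of the channel and `z` for the beam column. The gradient of the
rate at the beam has entries proportional to the means of `h_lᴴ (1 + γ h_z h_zᴴ)⁻¹ h_k`
(`beamPair`). Flipping the sign of one Gaussian entry shows that the means with `k ≠ l` vanish, so
only the diagonal of `Q` matters, and under the trace constraint the condition says that no diagonal
gradient entry exceeds the one at `z`.

The resolvent is explicit by Sherman–Morrison. With `m_i = beamMean (γ τ_z) ρ z i`, the entry at `z`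
is `∑ ρ_i m_i`; at `k ≠ z` the column is independent of `h_z`, and the entry is `γ τ_k ∑ ρ_i (1 -
ρ_i m_i)`. The worst competitor is the largest remaining `τ_k`. Sufficiency
(`isOptimalCovariance_of_le`) integrates the tangent inequality for `log det`. Necessity
(`le_of_isOptimalCovariance`) moves a share `ε` of the power to another column and lets `ε` tend to
`0` by dominated convergence.

To evaluate `m_i`, write `1 / (1 + S) = ∫ e^{-u(1+S)} du` over `u > 0`. The Gaussian average then
factorises over the antennas into `(1 + u a ρ_i)⁻¹ ∏ (1 + u a ρ_j)⁻¹`. Partial fractions, available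
because the `ρ_j` are distinct, reduce this to integrals with two factors, which are exactly the
`ζ_ij`. Rearranging with `∑ ρ_i = r` gives the stated inequality. -/

/-! ### Laplace integrals for `f` and `ζ_ij`, and partial fractions. -/

lemma integrableOn_exp_neg_mul_of_bounded {g : ℝ → ℝ} (C : ℝ)
    (hg : ContinuousOn g (Set.Ioi 0)) (hC : ∀ u, 0 < u → ‖g u‖ ≤ C) :
    IntegrableOn (fun u => Real.exp (-u) * g u) (Set.Ioi 0) := by
  have h := integrableOn_exp_neg_Ioi 0
  refine Integrable.mul_bdd (c := C) h (hg.aestronglyMeasurable measurableSet_Ioi) ?_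
  filter_upwards [ae_restrict_mem measurableSet_Ioi] with u hu using hC u hu

lemma one_add_mul_pos {u c : ℝ} (hu : 0 ≤ u) (hc : 0 ≤ c) : 0 < 1 + u * c := by positivity

lemma integrableOn_exp_neg_mul_inv {c : ℝ} (hc : 0 ≤ c) :
    IntegrableOn (fun u => Real.exp (-u) * (1 + u * c)⁻¹) (Set.Ioi 0) := by
  refine integrableOn_exp_neg_mul_of_bounded 1 ?_ ?_
  · refine ContinuousOn.inv₀ (by fun_prop) fun u hu => (one_add_mul_pos hu.le hc).ne'
  · intro u hu
    have : 0 ≤ u * c := by positivity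
    rw [Real.norm_of_nonneg (by positivity)]
    exact inv_le_one_of_one_le₀ (by linarith)

/-- The shift `s = u + 1/x` absorbs the prefactor `e^{1/x}`. -/
lemma beamF_eq_integral {x : ℝ} (hx : 0 < x) :
    beamF x = ∫ u in Set.Ioi 0, Real.exp (-u) * (x * (1 + u * x)⁻¹) := by
  have h := (measurePreserving_add_right volume (1 / x)).setIntegral_preimage_emb
    (measurableEmbedding_addRight (1 / x)) (fun s : ℝ => s ^ ((0 : ℝ) - 1) * Real.exp (-s))
    (Set.Ioi (1 / x))
  rw [Set.preimage_add_const_Ioi, sub_self] at h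
  rw [beamF, upperIncompleteGamma, ← h, ← integral_const_mul]
  refine setIntegral_congr_fun measurableSet_Ioi fun u hu => ?_
  have hu : 0 < u := hu
  have h1 := one_add_mul_pos hu.le hx.le
  simp only [zero_sub, Real.rpow_neg_one]
  have : Real.exp (-(u + 1 / x)) = Real.exp (-u) * (Real.exp (1 / x))⁻¹ := by
    rw [← Real.exp_neg, ← Real.exp_add]; ring_nf
  rw [this]
  have : u + 1 / x = (1 + u * x) / x := by field_simp; ring
  rw [this]
  have := Real.exp_pos (1 / x)
  field_simp

/-- Integration by parts: `-p⁻¹ e^{-u} / (1 + u a p)` is a primitive of this integrand plus `p⁻¹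
e^{-u} / (1 + u a p)`. The boundary value at `0` gives `1 / p`. This is the diagonal coefficient
`ζ_ii`. -/
lemma integral_exp_neg_mul_inv_sq {a p : ℝ} (ha : 0 < a) (hp : 0 < p) :
    ∫ u in Set.Ioi 0, Real.exp (-u) * (a * ((1 + u * (a * p)) ^ 2)⁻¹)
      = 1 / p * (1 - beamF (a * p) / (a * p)) := by
  have hap : 0 < a * p := mul_pos ha hp
  have hsq : IntegrableOn (fun u => Real.exp (-u) * (a * ((1 + u * (a * p)) ^ 2)⁻¹))
      (Set.Ioi 0) := by
    refine integrableOn_exp_neg_mul_of_bounded a ?_ ?_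
    · refine ContinuousOn.mul continuousOn_const
        (ContinuousOn.inv₀ (by fun_prop) fun u hu => ?_)
      exact (pow_pos (one_add_mul_pos (le_of_lt hu) hap.le) 2).ne'
    · intro u hu
      have : 0 ≤ u * (a * p) := by positivity
      rw [Real.norm_of_nonneg (by positivity)]
      refine mul_le_of_le_one_right ha.le (inv_le_one_of_one_le₀ ?_)
      nlinarith
  have hone := (integrableOn_exp_neg_mul_inv hap.le).const_mul p⁻¹
  have hF : ∀ u ∈ Set.Ici (0 : ℝ), HasDerivAt
      (fun u => -(p⁻¹ * (Real.exp (-u) * (1 + u * (a * p))⁻¹)))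
      (p⁻¹ * (Real.exp (-u) * (1 + u * (a * p))⁻¹) +
        Real.exp (-u) * (a * ((1 + u * (a * p)) ^ 2)⁻¹)) u := by
    intro u hu
    have h1 := one_add_mul_pos hu hap.le
    have hd := (((hasDerivAt_id u).neg.exp).mul
      (((hasDerivAt_id u).mul_const (a * p)).const_add 1 |>.inv h1.ne')).const_mul p⁻¹ |>.neg
    refine hd.congr_deriv ?_
    simp only [id, Pi.neg_apply, Pi.inv_apply]
    field_simp
    ring
  have hlim : Filter.Tendsto (fun u => -(p⁻¹ * (Real.exp (-u) * (1 + u * (a * p))⁻¹)))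
      Filter.atTop (nhds 0) := by
    have h0 : Filter.Tendsto (fun u : ℝ => p⁻¹ * Real.exp (-u)) Filter.atTop (nhds 0) := by
      simpa using (Real.tendsto_exp_neg_atTop_nhds_zero).const_mul p⁻¹
    refine squeeze_zero_norm' ?_ h0
    filter_upwards [Filter.eventually_ge_atTop 0] with u hu
    have : 0 ≤ u * (a * p) := by positivity
    rw [norm_neg, Real.norm_of_nonneg (by positivity)]
    refine mul_le_mul_of_nonneg_left ?_ (by positivity)
    exact mul_le_of_le_one_right (Real.exp_pos _).le (inv_le_one_of_one_le₀ (by linarith))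
  have key := integral_Ioi_of_hasDerivAt_of_tendsto' hF (hone.add hsq) hlim
  rw [integral_add hone hsq, integral_const_mul] at key
  have hf : beamF (a * p) / (a * p)
      = ∫ u in Set.Ioi 0, Real.exp (-u) * (1 + u * (a * p))⁻¹ := by
    rw [beamF_eq_integral hap, div_eq_iff hap.ne', ← integral_mul_const]
    refine setIntegral_congr_fun measurableSet_Ioi fun u _ => ?_
    ring
  rw [hf]
  norm_num at key
  rw [one_div]
  linarith

/-- Off the diagonal this is `x/(1+ux) - y/(1+uy) = (x-y)/((1+ux)(1+uy))` under the integral; the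
diagonal is the confluent case. Both branches of the definition thus share one formula. -/
lemma beamZeta_eq_integral {r : ℕ} {a : ℝ} (ha : 0 < a) {ρ : Fin r → ℝ} (hρ : ∀ i, 0 < ρ i)
    (hinj : Function.Injective ρ) (i j : Fin r) :
    beamZeta a ρ i j =
      ∫ u in Set.Ioi 0, Real.exp (-u) * (a * ((1 + u * (a * ρ i))⁻¹ * (1 + u * (a * ρ j))⁻¹)) := by
  have hai := mul_pos ha (hρ i)
  have haj := mul_pos ha (hρ j)
  unfold beamZeta
  split_ifs with h
  · subst h
    rw [← integral_exp_neg_mul_inv_sq ha (hρ i)]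
    refine setIntegral_congr_fun measurableSet_Ioi fun u _ => ?_
    simp only [sq, mul_inv]
  · have hne : ρ i - ρ j ≠ 0 := sub_ne_zero.2 fun e => h (hinj e)
    rw [beamF_eq_integral hai, beamF_eq_integral haj, div_eq_iff hne, ← integral_sub,
      ← integral_mul_const]
    · refine setIntegral_congr_fun measurableSet_Ioi fun u hu => ?_
      have h1 := one_add_mul_pos (le_of_lt hu) hai.le
      have h2 := one_add_mul_pos (le_of_lt hu) haj.le
      linear_combination -(Real.exp (-u) * (a * ρ i) * (1 + u * (a * ρ i))⁻¹) *
        mul_inv_cancel₀ h2.ne' + Real.exp (-u) * (a * ρ j) * (1 + u * (a * ρ j))⁻¹ *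
        mul_inv_cancel₀ h1.ne'
    · refine ((integrableOn_exp_neg_mul_inv hai.le).const_mul (a * ρ i)).congr
        (.of_forall fun u => ?_)
      simp only; ring
    · refine ((integrableOn_exp_neg_mul_inv haj.le).const_mul (a * ρ j)).congr
        (.of_forall fun u => ?_)
      simp only; ring

/-- Partial fraction expansion of `∏ j, (1 + w ρ_j)⁻¹`. -/
lemma prod_inv_one_add_mul {r : ℕ} {ρ : Fin r → ℝ} (hr : 0 < r) (hρ : ∀ i, 0 < ρ i)
    (hinj : Function.Injective ρ) {w : ℝ} (hw : 0 < w) :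
    ∏ j, (1 + w * ρ j)⁻¹ =
      ∑ j, ρ j ^ (r - 1) / (∏ k ∈ Finset.univ.erase j, (ρ j - ρ k)) * (1 + w * ρ j)⁻¹ := by
  have hpos : ∀ j, 0 < 1 + w * ρ j := fun j => one_add_mul_pos hw.le (hρ j).le
  have hx : ∀ j, -w⁻¹ - ρ j = -w⁻¹ * (1 + w * ρ j) := fun j => by field_simp; ring
  -- Interpolation at `r` nodes reproduces `X ^ (r - 1)`, whose degree is below `r`. This is the
  -- source of the numerators `ρ_j ^ (r - 1)`.
  have hint : Lagrange.interpolate Finset.univ ρ (fun j => ρ j ^ (r - 1))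
      = (Polynomial.X : Polynomial ℝ) ^ (r - 1) := by
    symm
    refine Lagrange.eq_interpolate_of_eval_eq _ hinj.injOn ?_ (by simp)
    rw [Polynomial.degree_X_pow, Finset.card_univ, Fintype.card_fin]
    exact_mod_cast Nat.sub_lt hr one_pos
  -- At the point `-1/w` each node factor becomes `-(1 + w ρ_j) / w`; the point is negative, hence
  -- not a node.
  have h := Lagrange.eval_interpolate_not_at_node (s := Finset.univ) (v := ρ)
    (fun j => ρ j ^ (r - 1)) (x := -w⁻¹) (fun j _ e => by
      linarith [hρ j, inv_pos.2 hw])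
  rw [hint, Lagrange.eval_nodal] at h
  simp only [Polynomial.eval_pow, Polynomial.eval_X, hx, Lagrange.nodalWeight, mul_inv,
    Finset.prod_mul_distrib, Finset.prod_const, Finset.card_univ, Fintype.card_fin] at h
  have hP : ∏ j, (1 + w * ρ j) ≠ 0 := Finset.prod_ne_zero_iff.2 fun j _ => (hpos j).ne'
  have hw' : (-w⁻¹) ≠ 0 := neg_ne_zero.2 (inv_ne_zero hw.ne')
  have hpow : (-w⁻¹) ^ r = (-w⁻¹) ^ (r - 1) * (-w⁻¹) := by
    rw [← pow_succ, Nat.sub_add_cancel hr]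
  have hsum : ∑ x, (∏ j ∈ Finset.univ.erase x, (ρ x - ρ j)⁻¹) *
      ((-w⁻¹)⁻¹ * (1 + w * ρ x)⁻¹) * ρ x ^ (r - 1) = (-w⁻¹)⁻¹ *
      ∑ j, ρ j ^ (r - 1) / (∏ k ∈ Finset.univ.erase j, (ρ j - ρ k)) * (1 + w * ρ j)⁻¹ := by
    rw [Finset.mul_sum]
    refine Finset.sum_congr rfl fun j _ => ?_
    rw [Finset.prod_inv_distrib]
    ring
  rw [hpow, hsum] at h
  rw [Finset.prod_inv_distrib]
  refine inv_eq_of_mul_eq_one_right ?_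
  refine mul_left_cancel₀ (pow_ne_zero (r - 1) hw') ?_
  rw [mul_one]
  conv_rhs => rw [h]
  field_simp

/-- The Laplace transform representation of the beamforming sum. -/
lemma sum_mul_beamZeta_eq_integral {r : ℕ} {a : ℝ} (ha : 0 < a) {ρ : Fin r → ℝ}
    (hρ : ∀ i, 0 < ρ i) (hinj : Function.Injective ρ) (i : Fin r) :
    ∑ j, ρ j ^ (r - 1) / (∏ k ∈ Finset.univ.erase j, (ρ j - ρ k)) * beamZeta a ρ i j =
      ∫ u in Set.Ioi 0,
        Real.exp (-u) * (a * ((1 + u * (a * ρ i))⁻¹ * ∏ j, (1 + u * (a * ρ j))⁻¹)) := by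
  have hint : ∀ j, IntegrableOn (fun u => Real.exp (-u) *
      (a * ((1 + u * (a * ρ i))⁻¹ * (1 + u * (a * ρ j))⁻¹))) (Set.Ioi 0) := by
    intro j
    have hai := mul_pos ha (hρ i)
    have haj := mul_pos ha (hρ j)
    refine integrableOn_exp_neg_mul_of_bounded a ?_ ?_
    · refine ContinuousOn.mul continuousOn_const (ContinuousOn.mul
        (ContinuousOn.inv₀ (by fun_prop) fun u hu => ?_)
        (ContinuousOn.inv₀ (by fun_prop) fun u hu => ?_))
      · exact (one_add_mul_pos (le_of_lt hu) hai.le).ne'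
      · exact (one_add_mul_pos (le_of_lt hu) haj.le).ne'
    · intro u hu
      have h1 : 0 ≤ u * (a * ρ i) := by positivity
      have h2 : 0 ≤ u * (a * ρ j) := by positivity
      rw [Real.norm_of_nonneg (by positivity)]
      exact mul_le_of_le_one_right ha.le (mul_le_one₀ (inv_le_one_of_one_le₀ (by linarith))
        (by positivity) (inv_le_one_of_one_le₀ (by linarith)))
  simp_rw [beamZeta_eq_integral ha hρ hinj, ← integral_const_mul]
  rw [← integral_finsetSum _ fun j _ => (hint j).const_mul _]
  refine setIntegral_congr_fun measurableSet_Ioi fun u hu => ?_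
  have hu : 0 < u := hu
  have hpf := prod_inv_one_add_mul i.pos hρ hinj (mul_pos hu ha)
  simp only [mul_assoc] at hpf
  rw [hpf, Finset.mul_sum, Finset.mul_sum, Finset.mul_sum]
  refine Finset.sum_congr rfl fun j _ => ?_
  ring

/-! ### Exponentially tilted moments of the complex Gaussian. -/

instance instIsProbabilityMeasureStdComplexGaussian :
    IsProbabilityMeasure stdComplexGaussian :=
  Measure.isProbabilityMeasure_map
    (Complex.measurableEquivRealProd.symm.measurable.aemeasurable (μ := _))

lemma integral_stdComplexGaussian (f : ℂ → ℝ) :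
    ∫ z, f z ∂stdComplexGaussian =
      ∫ p : ℝ × ℝ, f ⟨p.1, p.2⟩ ∂((gaussianReal 0 (1 / 2)).prod (gaussianReal 0 (1 / 2))) :=
  integral_map_equiv Complex.measurableEquivRealProd.symm f

/-- At variance `1/2` the density is proportional to `e^{-x²}`, so the tilt produces `e^{-(1+c)x²}`,
again Gaussian up to normalisation. -/
lemma gaussianPDFReal_half_mul_exp {c : ℝ} (hc : 0 ≤ c) (x : ℝ) :
    gaussianPDFReal 0 (1 / 2) x * Real.exp (-(c * x ^ 2)) =
      (√(1 + c))⁻¹ * gaussianPDFReal 0 (Real.toNNReal (1 / (2 * (1 + c)))) x := by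
  have h1 : 0 < 1 + c := by linarith
  have h2 : ((1 / 2 : NNReal) : ℝ) = 1 / 2 := by simp
  rw [gaussianPDFReal, gaussianPDFReal, Real.coe_toNNReal _ (by positivity), h2, mul_assoc,
    ← Real.exp_add, ← mul_assoc, ← mul_inv, ← Real.sqrt_mul h1.le]
  have h3 : 2 * (1 / (2 * (1 + c))) = (1 + c)⁻¹ := by field_simp
  have h4 : (1 + c) * (2 * Real.pi * (1 / (2 * (1 + c)))) = 2 * Real.pi * (1 / 2) := by field_simp
  rw [h3, h4, div_inv_eq_mul]
  congr 2
  ring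

lemma integral_exp_neg_mul_sq_gaussianReal_half {c : ℝ} (hc : 0 ≤ c) :
    ∫ x, Real.exp (-(c * x ^ 2)) ∂gaussianReal 0 (1 / 2) = (√(1 + c))⁻¹ := by
  have hv : Real.toNNReal (1 / (2 * (1 + c))) ≠ 0 := by
    rw [ne_eq, Real.toNNReal_eq_zero, not_le]; positivity
  rw [integral_gaussianReal_eq_integral_smul (by norm_num)]
  simp_rw [smul_eq_mul, gaussianPDFReal_half_mul_exp hc]
  rw [integral_const_mul, integral_gaussianPDFReal_eq_one _ hv, mul_one]

lemma integral_sq_gaussianReal_zero (v : NNReal) : ∫ x, x ^ 2 ∂gaussianReal 0 v = v := by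
  have h := variance_fun_id_gaussianReal (μ := 0) (v := v)
  rwa [variance_of_integral_eq_zero (by fun_prop) (by simp)] at h

lemma integral_sq_mul_exp_gaussianReal_half {c : ℝ} (hc : 0 ≤ c) :
    ∫ x, x ^ 2 * Real.exp (-(c * x ^ 2)) ∂gaussianReal 0 (1 / 2)
      = (√(1 + c))⁻¹ * (1 / (2 * (1 + c))) := by
  have hv : Real.toNNReal (1 / (2 * (1 + c))) ≠ 0 := by
    rw [ne_eq, Real.toNNReal_eq_zero, not_le]; positivity
  have h := integral_sq_gaussianReal_zero (Real.toNNReal (1 / (2 * (1 + c))))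
  rw [integral_gaussianReal_eq_integral_smul hv, Real.coe_toNNReal _ (by positivity)] at h
  rw [integral_gaussianReal_eq_integral_smul (by norm_num), ← h, ← integral_const_mul]
  refine integral_congr_ae (.of_forall fun x => ?_)
  have := gaussianPDFReal_half_mul_exp hc x
  simp only [smul_eq_mul]
  linear_combination x ^ 2 * this

lemma integrable_sq_mul_exp_gaussianReal {c : ℝ} (hc : 0 ≤ c) (v : NNReal) :
    Integrable (fun x : ℝ => x ^ 2 * Real.exp (-(c * x ^ 2))) (gaussianReal 0 v) := by
  have h : Integrable (fun x : ℝ => x ^ 2) (gaussianReal 0 v) :=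
    (memLp_id_gaussianReal' 2 (by simp)).integrable_sq
  refine h.mul_bdd (c := 1) (by fun_prop) (.of_forall fun x => ?_)
  rw [Real.norm_of_nonneg (Real.exp_pos _).le, Real.exp_le_one_iff, neg_nonpos]
  positivity

lemma integrable_exp_neg_mul_sq_gaussianReal {c : ℝ} (hc : 0 ≤ c) (v : NNReal) :
    Integrable (fun x : ℝ => Real.exp (-(c * x ^ 2))) (gaussianReal 0 v) := by
  refine (integrable_const (1 : ℝ)).mono' (by fun_prop) (.of_forall fun x => ?_)
  rw [Real.norm_of_nonneg (Real.exp_pos _).le, Real.exp_le_one_iff, neg_nonpos]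
  positivity

lemma exp_neg_mul_norm_sq (c x y : ℝ) :
    Real.exp (-(c * ‖(⟨x, y⟩ : ℂ)‖ ^ 2)) =
      Real.exp (-(c * x ^ 2)) * Real.exp (-(c * y ^ 2)) := by
  rw [Complex.sq_norm, Complex.normSq_mk, ← Real.exp_add]
  ring_nf

lemma integral_exp_neg_mul_norm_sq {c : ℝ} (hc : 0 ≤ c) :
    ∫ z, Real.exp (-(c * ‖z‖ ^ 2)) ∂stdComplexGaussian = (1 + c)⁻¹ := by
  rw [integral_stdComplexGaussian]
  simp_rw [exp_neg_mul_norm_sq]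
  rw [integral_prod_mul (fun x : ℝ => Real.exp (-(c * x ^ 2)))
    (fun x : ℝ => Real.exp (-(c * x ^ 2))), integral_exp_neg_mul_sq_gaussianReal_half hc,
    ← mul_inv, Real.mul_self_sqrt (by linarith)]

lemma integral_norm_sq_mul_exp {c : ℝ} (hc : 0 ≤ c) :
    ∫ z, ‖z‖ ^ 2 * Real.exp (-(c * ‖z‖ ^ 2)) ∂stdComplexGaussian = ((1 + c) ^ 2)⁻¹ := by
  have h1 : 0 < 1 + c := by linarith
  rw [integral_stdComplexGaussian]
  have hsplit : ∀ p : ℝ × ℝ, ‖(⟨p.1, p.2⟩ : ℂ)‖ ^ 2 * Real.exp (-(c * ‖(⟨p.1, p.2⟩ : ℂ)‖ ^ 2)) =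
      p.1 ^ 2 * Real.exp (-(c * p.1 ^ 2)) * Real.exp (-(c * p.2 ^ 2)) +
      Real.exp (-(c * p.1 ^ 2)) * (p.2 ^ 2 * Real.exp (-(c * p.2 ^ 2))) := fun p => by
    rw [exp_neg_mul_norm_sq, Complex.sq_norm, Complex.normSq_mk]; ring
  simp_rw [hsplit]
  rw [integral_add
    ((integrable_sq_mul_exp_gaussianReal hc _).mul_prod
      (integrable_exp_neg_mul_sq_gaussianReal hc _))
    ((integrable_exp_neg_mul_sq_gaussianReal hc _).mul_prod
      (integrable_sq_mul_exp_gaussianReal hc _)),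
    integral_prod_mul (fun x : ℝ => x ^ 2 * Real.exp (-(c * x ^ 2)))
      (fun x : ℝ => Real.exp (-(c * x ^ 2))),
    integral_prod_mul (fun x : ℝ => Real.exp (-(c * x ^ 2)))
      (fun x : ℝ => x ^ 2 * Real.exp (-(c * x ^ 2))),
    integral_exp_neg_mul_sq_gaussianReal_half hc, integral_sq_mul_exp_gaussianReal_half hc]
  have h2 : (√(1 + c))⁻¹ * (√(1 + c))⁻¹ = (1 + c)⁻¹ := by
    rw [← mul_inv, Real.mul_self_sqrt h1.le]
  calc _ = (√(1 + c))⁻¹ * (√(1 + c))⁻¹ * (1 + c)⁻¹ := by field_simp; ring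
    _ = _ := by rw [h2]; field_simp

lemma integral_norm_sq_stdComplexGaussian : ∫ z, ‖z‖ ^ 2 ∂stdComplexGaussian = 1 := by
  simpa using integral_norm_sq_mul_exp le_rfl

lemma integrable_norm_sq_stdComplexGaussian :
    Integrable (fun z => ‖z‖ ^ 2) stdComplexGaussian :=
  -- A non-integrable function would have integral `0` by convention, whereas this integral is `1`.
  .of_integral_ne_zero (by simp [integral_norm_sq_stdComplexGaussian])

lemma measurePreserving_neg_stdComplexGaussian :
    MeasurePreserving (fun z : ℂ => -z) stdComplexGaussian stdComplexGaussian := by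
  have hneg : MeasurePreserving (fun x : ℝ => -x) (gaussianReal 0 (1 / 2))
      (gaussianReal 0 (1 / 2)) := ⟨measurable_neg, by rw [gaussianReal_map_neg, neg_zero]⟩
  have hprod := hneg.prod hneg
  refine ⟨measurable_neg, ?_⟩
  have hm : Measurable fun p : ℝ × ℝ => (⟨p.1, p.2⟩ : ℂ) :=
    Complex.measurableEquivRealProd.symm.measurable
  conv_rhs => rw [stdComplexGaussian, ← hprod.map_eq]
  rw [stdComplexGaussian, Measure.map_map measurable_neg hm, Measure.map_map hm hprod.measurable]
  congr 1

/-! ### The Gaussian matrix: independence and sign symmetry. -/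

section

variable {r t : ℕ}

instance instBorelSpaceMatrix : BorelSpace (Matrix (Fin r) (Fin t) ℂ) :=
  inferInstanceAs (BorelSpace (Fin r → Fin t → ℂ))

instance instIsProbabilityMeasureStdGaussianMatrix :
    IsProbabilityMeasure (stdGaussianMatrix r t) :=
  inferInstanceAs (IsProbabilityMeasure
    (Measure.pi fun _ : Fin r => Measure.pi fun _ : Fin t => stdComplexGaussian))

lemma measurePreserving_entry (i : Fin r) (k : Fin t) :
    MeasurePreserving (fun G : Matrix (Fin r) (Fin t) ℂ => G i k)
      (stdGaussianMatrix r t) stdComplexGaussian :=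
  (measurePreserving_eval (fun _ : Fin t => stdComplexGaussian) k).comp
    (measurePreserving_eval
      (fun _ : Fin r => Measure.pi fun _ : Fin t => stdComplexGaussian) i)

lemma measurable_entry (i : Fin r) (k : Fin t) :
    Measurable (fun G : Matrix (Fin r) (Fin t) ℂ => G i k) :=
  (measurePreserving_entry i k).measurable

lemma continuous_entry (i : Fin r) (k : Fin t) :
    Continuous (fun G : Matrix (Fin r) (Fin t) ℂ => G i k) :=
  continuous_id.matrix_elem i k

lemma integral_comp_entry {f : ℂ → ℝ} (hf : Measurable f) (i : Fin r) (k : Fin t) :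
    ∫ G, f (G i k) ∂stdGaussianMatrix r t = ∫ z, f z ∂stdComplexGaussian := by
  rw [← (measurePreserving_entry (r := r) (t := t) i k).map_eq, integral_map
    (measurable_entry i k).aemeasurable hf.aestronglyMeasurable]

lemma integrable_norm_sq_entry (i : Fin r) (k : Fin t) :
    Integrable (fun G => ‖G i k‖ ^ 2) (stdGaussianMatrix r t) :=
  ((measurePreserving_entry i k).integrable_comp
    integrable_norm_sq_stdComplexGaussian.aestronglyMeasurable).2
    integrable_norm_sq_stdComplexGaussian

lemma integral_norm_sq_entry (i : Fin r) (k : Fin t) :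
    ∫ G, ‖G i k‖ ^ 2 ∂stdGaussianMatrix r t = 1 := by
  rw [integral_comp_entry (f := fun z => ‖z‖ ^ 2) (by fun_prop),
    integral_norm_sq_stdComplexGaussian]

lemma integral_prod_column {F : Fin r → ℂ → ℝ} (hF : ∀ j, Measurable (F j)) (k : Fin t) :
    ∫ G, ∏ j, F j (G j k) ∂stdGaussianMatrix r t = ∏ j, ∫ z, F j z ∂stdComplexGaussian := by
  have h := integral_fintype_prod_eq_prod (𝕜 := ℝ)
    (μ := fun _ : Fin r => Measure.pi fun _ : Fin t => stdComplexGaussian)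
    (fun j (g : Fin t → ℂ) => F j (g k))
  refine h.trans (Finset.prod_congr rfl fun j _ => ?_)
  exact integral_comp_eval (μ := fun _ : Fin t => stdComplexGaussian) (i := k)
    (hF j).aestronglyMeasurable

lemma iIndepFun_entry :
    iIndepFun (fun (p : Fin r × Fin t) (G : Matrix (Fin r) (Fin t) ℂ) => G p.1 p.2)
      (stdGaussianMatrix r t) := by
  have h := iIndepFun_uncurry_infinitePi' (fun (_ : Fin r) (_ : Fin t) => stdComplexGaussian)
    (X := fun _ _ z => z) (fun _ _ => measurable_id)
  simp only [Measure.infinitePi_eq_pi] at h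
  exact h

/-- An entry outside column `z` is independent of that column and has second moment one, so its
squared norm averages out. -/
lemma integral_norm_sq_entry_mul {z k : Fin t} (hk : k ≠ z) (i : Fin r)
    {φ : (Fin r → ℂ) → ℝ} (hφ : Measurable φ) :
    ∫ G, ‖G i k‖ ^ 2 * φ (fun j => G j z) ∂stdGaussianMatrix r t =
      ∫ G, φ (fun j => G j z) ∂stdGaussianMatrix r t := by
  classical
  have h := (iIndepFun_entry (r := r) (t := t)).indepFun_finset {(i, k)}
    (Finset.univ.image fun j => (j, z)) (by
      rw [Finset.disjoint_singleton_left]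
      simp only [Finset.mem_image, Finset.mem_univ, true_and, Prod.mk.injEq, not_exists, not_and]
      exact fun j _ e => hk e.symm) (fun p => measurable_entry p.1 p.2)
  have hi : (i, k) ∈ ({(i, k)} : Finset (Fin r × Fin t)) := Finset.mem_singleton_self _
  have hj : ∀ j : Fin r, (j, z) ∈ Finset.univ.image (fun j : Fin r => (j, z)) := fun j =>
    Finset.mem_image_of_mem _ (Finset.mem_univ j)
  have h2 := h.comp (φ := fun x => ‖x ⟨(i, k), hi⟩‖ ^ 2)
    (ψ := fun y => φ fun j => y ⟨(j, z), hj j⟩)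
    (by fun_prop) (hφ.comp (by fun_prop))
  have h3 := h2.integral_fun_mul_eq_mul_integral
    (((measurable_entry i k).norm.pow_const 2).aestronglyMeasurable)
    (Measurable.aestronglyMeasurable
      (hφ.comp (measurable_pi_lambda _ fun j => measurable_entry j z)))
  refine h3.trans ?_
  have h1 : ∫ G, ‖G i k‖ ^ 2 ∂stdGaussianMatrix r t = 1 := integral_norm_sq_entry i k
  simp only [Function.comp_def]
  rw [h1, one_mul]

/-- Change the sign of one entry. -/
def negEntry (i : Fin r) (k : Fin t) (G : Matrix (Fin r) (Fin t) ℂ) :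
    Matrix (Fin r) (Fin t) ℂ :=
  fun j l => if j = i ∧ l = k then -G j l else G j l

lemma measurePreserving_negEntry (i : Fin r) (k : Fin t) :
    MeasurePreserving (negEntry i k) (stdGaussianMatrix r t) (stdGaussianMatrix r t) := by
  refine measurePreserving_pi (fun _ : Fin r => Measure.pi fun _ : Fin t => stdComplexGaussian)
    (fun _ : Fin r => Measure.pi fun _ : Fin t => stdComplexGaussian)
    (f := fun j g l => if j = i ∧ l = k then -g l else g l) fun j => ?_
  refine measurePreserving_pi (fun _ : Fin t => stdComplexGaussian)
    (fun _ : Fin t => stdComplexGaussian)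
    (f := fun l w => if j = i ∧ l = k then -w else w) fun l => ?_
  by_cases h : j = i ∧ l = k
  · simpa only [h, and_self, if_true] using measurePreserving_neg_stdComplexGaussian
  · simp only [h, if_false]
    exact MeasurePreserving.id stdComplexGaussian

lemma negEntry_negEntry (i : Fin r) (k : Fin t) (G : Matrix (Fin r) (Fin t) ℂ) :
    negEntry i k (negEntry i k G) = G := by
  ext j l
  by_cases h : j = i ∧ l = k <;> simp [negEntry, h]

/-- The flip preserves the law, so the integral equals its own negative. Integrability is not
needed, because the integral is `0` by convention otherwise. -/
lemma integral_eq_zero_of_negEntry (i : Fin r) (k : Fin t)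
    {F : Matrix (Fin r) (Fin t) ℂ → ℂ} (hF : ∀ G, F (negEntry i k G) = -F G) :
    ∫ G, F G ∂stdGaussianMatrix r t = 0 := by
  let e : Matrix (Fin r) (Fin t) ℂ ≃ᵐ Matrix (Fin r) (Fin t) ℂ :=
    { toFun := negEntry i k, invFun := negEntry i k
      left_inv := negEntry_negEntry i k, right_inv := negEntry_negEntry i k
      measurable_toFun := (measurePreserving_negEntry i k).measurable
      measurable_invFun := (measurePreserving_negEntry i k).measurable }
  have h : ∫ G, F (negEntry i k G) ∂stdGaussianMatrix r t = ∫ G, F G ∂stdGaussianMatrix r t :=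
    (measurePreserving_negEntry i k).integral_comp e.measurableEmbedding F
  simp_rw [hF, integral_neg] at h
  exact CharZero.eq_neg_self_iff.1 h.symm

/-! ### The mean shares `beamMean` and their closed form. -/

/-- The signal-to-noise ratio of the column `z`. -/
def beamGain (a : ℝ) (ρ : Fin r → ℝ) (z : Fin t) (G : Matrix (Fin r) (Fin t) ℂ) : ℝ :=
  ∑ j, a * ρ j * ‖G j z‖ ^ 2

lemma beamGain_nonneg {a : ℝ} (ha : 0 ≤ a) {ρ : Fin r → ℝ} (hρ : ∀ i, 0 < ρ i) (z : Fin t)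
    (G : Matrix (Fin r) (Fin t) ℂ) : 0 ≤ beamGain a ρ z G :=
  Finset.sum_nonneg fun j _ => mul_nonneg (mul_nonneg ha (hρ j).le) (by positivity)

lemma continuous_beamGain (a : ℝ) (ρ : Fin r → ℝ) (z : Fin t) :
    Continuous (beamGain a ρ z) :=
  continuous_finsetSum _ fun j _ => ((continuous_entry j z).norm.pow 2).const_mul _

/-- The mean share of the receive antenna `i` in the gain of the column `z`. -/
def beamMean (a : ℝ) (ρ : Fin r → ℝ) (z : Fin t) (i : Fin r) : ℝ :=
  ∫ G, a * ‖G i z‖ ^ 2 / (1 + beamGain a ρ z G) ∂stdGaussianMatrix r t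

lemma integral_exp_neg_mul_Ioi {c : ℝ} (hc : 0 < c) :
    ∫ u in Set.Ioi 0, Real.exp (-(u * c)) = c⁻¹ := by
  have h := integral_exp_mul_Ioi (a := -c) (by linarith) 0
  rw [mul_zero, Real.exp_zero, neg_div_neg_eq, one_div] at h
  rw [← h]
  congr 1; ext u; ring_nf

/-- The exponent is a sum over independent entries, so the mean factorises. The weight `‖G i z‖ ^ 2`
squares the `i`-th factor, which is the extra factor in front. -/
lemma integral_norm_sq_mul_exp_beamGain {a : ℝ} (ha : 0 ≤ a) {ρ : Fin r → ℝ}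
    (hρ : ∀ i, 0 < ρ i) (z : Fin t) (i : Fin r) {u : ℝ} (hu : 0 ≤ u) :
    ∫ G, ‖G i z‖ ^ 2 * Real.exp (-(u * beamGain a ρ z G)) ∂stdGaussianMatrix r t =
      (1 + u * (a * ρ i))⁻¹ * ∏ j, (1 + u * (a * ρ j))⁻¹ := by
  let F : Fin r → ℂ → ℝ := fun j w =>
    (if j = i then ‖w‖ ^ 2 else 1) * Real.exp (-(u * (a * ρ j) * ‖w‖ ^ 2))
  have hF : ∀ j, Measurable (F j) := fun j => by
    by_cases h : j = i <;> simp only [F, h, if_true, if_false] <;> fun_prop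
  have hc : ∀ j, 0 ≤ u * (a * ρ j) := fun j => mul_nonneg hu (mul_nonneg ha (hρ j).le)
  have hprod : ∀ G : Matrix (Fin r) (Fin t) ℂ,
      ‖G i z‖ ^ 2 * Real.exp (-(u * beamGain a ρ z G)) = ∏ j, F j (G j z) := fun G => by
    simp only [F, Finset.prod_mul_distrib, ← Real.exp_sum, Finset.prod_ite_eq',
      Finset.mem_univ, if_true, beamGain]
    rw [Finset.mul_sum, ← Finset.sum_neg_distrib]
    congr 3; ext j; ring
  simp_rw [hprod]
  rw [integral_prod_column hF]
  have hval : ∀ j, ∫ w, F j w ∂stdComplexGaussian =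
      (if j = i then (1 + u * (a * ρ j))⁻¹ else 1) * (1 + u * (a * ρ j))⁻¹ := fun j => by
    by_cases h : j = i
    · simp only [F, h, if_true]
      rw [integral_norm_sq_mul_exp (hc i), sq, mul_inv]
    · simp only [F, h, if_false, one_mul]
      exact integral_exp_neg_mul_norm_sq (hc j)
  simp_rw [hval]
  rw [Finset.prod_mul_distrib, Finset.prod_ite_eq', if_pos (Finset.mem_univ _)]

/-- Fubini after writing the reciprocal of `1 + beamGain` as `∫ e^{-u(1 + beamGain)} du`. -/
lemma beamMean_eq_integral {a : ℝ} (ha : 0 < a) {ρ : Fin r → ℝ}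
    (hρ : ∀ i, 0 < ρ i) (z : Fin t) (i : Fin r) :
    beamMean a ρ z i = ∫ u in Set.Ioi 0,
      Real.exp (-u) * (a * ((1 + u * (a * ρ i))⁻¹ * ∏ j, (1 + u * (a * ρ j))⁻¹)) := by
  have hinner : ∀ G : Matrix (Fin r) (Fin t) ℂ, a * ‖G i z‖ ^ 2 / (1 + beamGain a ρ z G) =
      ∫ u in Set.Ioi 0,
        a * ‖G i z‖ ^ 2 * Real.exp (-u) * Real.exp (-(u * beamGain a ρ z G)) := fun G => by
    have hS := beamGain_nonneg ha.le hρ z G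
    rw [div_eq_mul_inv, ← integral_exp_neg_mul_Ioi (by linarith : 0 < 1 + beamGain a ρ z G),
      ← integral_const_mul]
    congr 1; ext u
    have h : Real.exp (-(u * (1 + beamGain a ρ z G))) =
        Real.exp (-u) * Real.exp (-(u * beamGain a ρ z G)) := by
      rw [← Real.exp_add]; ring_nf
    rw [h, ← mul_assoc]
  have hint : Integrable (Function.uncurry fun (G : Matrix (Fin r) (Fin t) ℂ) (u : ℝ) =>
      a * ‖G i z‖ ^ 2 * Real.exp (-u) * Real.exp (-(u * beamGain a ρ z G)))
      ((stdGaussianMatrix r t).prod (volume.restrict (Set.Ioi 0))) := by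
    -- Without the factor `e^{-u S}`, which is at most `1`, the integrand is a product of two
    -- integrable functions of separate variables.
    have h1 := ((integrable_norm_sq_entry i z).const_mul a).mul_prod
      (ν := volume.restrict (Set.Ioi 0)) (integrableOn_exp_neg_Ioi 0)
    refine Integrable.mul_bdd (c := 1) h1 ?_ ?_
    · have := (continuous_beamGain (t := t) a ρ z).measurable
      exact Measurable.aestronglyMeasurable (by fun_prop)
    · have h2 : ∀ᵐ u : ℝ ∂(volume.restrict (Set.Ioi 0)), 0 < u := ae_restrict_mem measurableSet_Ioi
      filter_upwards [(Measure.quasiMeasurePreserving_snd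
        (μ := stdGaussianMatrix r t) (ν := volume.restrict (Set.Ioi (0 : ℝ)))).ae h2] with p hp
      rw [Real.norm_of_nonneg (Real.exp_pos _).le, Real.exp_le_one_iff, neg_nonpos]
      exact mul_nonneg hp.le (beamGain_nonneg ha.le hρ z p.1)
  rw [beamMean]
  simp_rw [hinner]
  rw [integral_integral_swap hint]
  refine setIntegral_congr_fun measurableSet_Ioi fun u hu => ?_
  rw [← integral_norm_sq_mul_exp_beamGain (t := t) ha.le hρ z i (le_of_lt hu),
    ← integral_const_mul, ← integral_const_mul]
  congr 1; ext G; ring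

lemma beamMean_eq_sum_beamZeta {a : ℝ} (ha : 0 < a) {ρ : Fin r → ℝ}
    (hρ : ∀ i, 0 < ρ i) (hinj : Function.Injective ρ) (z : Fin t) (i : Fin r) :
    beamMean a ρ z i =
      ∑ j, ρ j ^ (r - 1) / (∏ k ∈ Finset.univ.erase j, (ρ j - ρ k)) * beamZeta a ρ i j := by
  rw [beamMean_eq_integral ha hρ, sum_mul_beamZeta_eq_integral ha hρ hinj]

end

/-! ### The tangent inequality for `log det`. -/

section LogDet

variable {n : Type*} [Fintype n] [DecidableEq n]

lemma ofReal_re_det {M : Matrix n n ℂ} (hM : M.IsHermitian) : ((M.det.re : ℝ) : ℂ) = M.det := by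
  rw [hM.det_eq_prod_eigenvalues]
  simp [← Complex.ofReal_prod]

lemma re_det_pos {M : Matrix n n ℂ} (hM : M.PosDef) : 0 < M.det.re :=
  (Complex.pos_iff.1 hM.det_pos).1

/-- Apply `log x ≤ x - 1` to each eigenvalue; this is the tangent inequality at the identity. -/
lemma log_det_le_trace_sub_card {M : Matrix n n ℂ} (hM : M.PosDef) :
    Real.log M.det.re ≤ M.trace.re - Fintype.card n := by
  have hpos := hM.eigenvalues_pos
  have hdet : M.det.re = ∏ i, hM.1.eigenvalues i := by
    rw [hM.1.det_eq_prod_eigenvalues]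
    simp [← Complex.ofReal_prod]
  have htr : M.trace.re = ∑ i, hM.1.eigenvalues i := by
    rw [hM.1.trace_eq_sum_eigenvalues]
    simp
  rw [hdet, htr, Real.log_prod fun i _ => (hpos i).ne']
  calc _ ≤ ∑ i, (hM.1.eigenvalues i - 1) :=
        Finset.sum_le_sum fun i _ => Real.log_le_sub_one_of_pos (hpos i)
    _ = _ := by simp

lemma exists_isHermitian_mul_self_eq {A : Matrix n n ℂ} (hA : A.PosSemidef) :
    ∃ C : Matrix n n ℂ, Cᴴ = C ∧ C * C = A := by
  have hA' : 0 ≤ A := Matrix.nonneg_iff_posSemidef.2 hA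
  exact ⟨CFC.sqrt A, (Matrix.nonneg_iff_posSemidef.1 (CFC.sqrt_nonneg A)).1,
    CFC.sqrt_mul_sqrt_self A hA'⟩

/-- Concavity of `log det`: the graph lies below its tangent at `A`. -/
lemma log_det_le {A M : Matrix n n ℂ} (hA : A.PosDef) (hM : M.PosDef) :
    Real.log M.det.re ≤ Real.log A.det.re + (A⁻¹ * M).trace.re - Fintype.card n := by
  -- With `C = A^{-1/2}`, the congruence `M ↦ C M C` moves the tangent point from `A` to the
  -- identity.
  obtain ⟨C, hC, hCC⟩ := exists_isHermitian_mul_self_eq hA.inv.posSemidef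
  have hdet : (C * M * C).det = (A.det)⁻¹ * M.det := by
    rw [Matrix.det_mul, Matrix.det_mul, mul_right_comm, ← Matrix.det_mul, hCC,
      Matrix.det_nonsing_inv, Ring.inverse_eq_inv]
  have hA0 := hA.det_pos.ne'
  have hM0 := hM.det_pos.ne'
  have hN : (C * M * C).PosDef := by
    have h := hM.posSemidef.mul_mul_conjTranspose_same C
    rw [hC] at h
    rw [h.posDef_iff_det_ne_zero, hdet]
    exact mul_ne_zero (inv_ne_zero hA0) hM0
  have h := log_det_le_trace_sub_card hN
  have htr : (C * M * C).trace = (A⁻¹ * M).trace := by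
    rw [Matrix.trace_mul_comm, ← mul_assoc, hCC]
  have hre : (C * M * C).det.re = (A.det.re)⁻¹ * M.det.re := by
    rw [hdet, ← ofReal_re_det hA.1, ← ofReal_re_det hM.1, ← Complex.ofReal_inv,
      ← Complex.ofReal_mul]
    simp
  have hAp := re_det_pos hA
  have hMp := re_det_pos hM
  rw [hre, Real.log_mul (inv_ne_zero hAp.ne') hMp.ne', Real.log_inv, htr] at h
  linarith

lemma re_trace_mul_nonneg {A P : Matrix n n ℂ} (hA : A.PosSemidef) (hP : P.PosSemidef) :
    0 ≤ (A * P).trace.re := by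
  obtain ⟨C, hC, hCC⟩ := exists_isHermitian_mul_self_eq hA
  have h := (hP.mul_mul_conjTranspose_same C).trace_nonneg
  rw [hC, Matrix.trace_mul_comm, ← mul_assoc, hCC] at h
  exact (Complex.nonneg_iff.1 h).1

/-- The tangent at `1 + P`, evaluated at `1`, bounds `0` above by `log det (1 + P) - tr ((1 + P)⁻¹
P)`, and the trace is nonnegative. -/
lemma log_det_one_add_nonneg {P : Matrix n n ℂ} (hP : P.PosSemidef) :
    0 ≤ Real.log (1 + P).det.re := by
  have hA := Matrix.PosDef.one.add_posSemidef hP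
  have h := log_det_le hA Matrix.PosDef.one
  have htr : ((1 + P)⁻¹ * 1).trace = (Fintype.card n : ℂ) - ((1 + P)⁻¹ * P).trace := by
    have h1 : (1 + P)⁻¹ * (1 + P) = 1 :=
      Matrix.nonsing_inv_mul _ (Matrix.isUnit_iff_isUnit_det _ |>.1 hA.isUnit)
    have h2 := congrArg Matrix.trace h1
    rw [mul_add, Matrix.trace_add, Matrix.trace_one] at h2
    exact eq_sub_of_add_eq h2
  have h3 := re_trace_mul_nonneg hA.inv.posSemidef hP
  rw [htr] at h
  simp at h
  linarith

end LogDet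

/-! ### Rank-one resolvents and the gradient entries `beamPair`. -/

section RankOne

variable {r t : ℕ}

/-- The squared Euclidean norm of a complex vector. -/
def normSqSum (h : Fin r → ℂ) : ℝ := ∑ i, ‖h i‖ ^ 2

lemma normSqSum_nonneg (h : Fin r → ℂ) : 0 ≤ normSqSum h :=
  Finset.sum_nonneg fun _ _ => by positivity

lemma star_dotProduct_self (h : Fin r → ℂ) : star h ⬝ᵥ h = (normSqSum h : ℂ) := by
  simp only [dotProduct, normSqSum, Pi.star_apply, Complex.ofReal_sum, Complex.ofReal_pow]
  exact Finset.sum_congr rfl fun i _ => Complex.conj_mul' (h i)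

lemma norm_star_dotProduct_sq_le (h g : Fin r → ℂ) :
    ‖star h ⬝ᵥ g‖ ^ 2 ≤ normSqSum h * normSqSum g := by
  have h1 : ‖star h ⬝ᵥ g‖ ≤ ∑ i, ‖h i‖ * ‖g i‖ := by
    refine (norm_sum_le _ _).trans (le_of_eq ?_)
    simp
  have h2 := Finset.sum_mul_sq_le_sq_mul_sq Finset.univ (fun i => ‖h i‖) fun i => ‖g i‖
  exact (pow_le_pow_left₀ (norm_nonneg _) h1 2).trans h2

/-- The inverse of `1 + γ h hᴴ`. -/
def rankOneResolvent (γ : ℝ) (h : Fin r → ℂ) : Matrix (Fin r) (Fin r) ℂ :=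
  1 - ((γ / (1 + γ * normSqSum h) : ℝ) : ℂ) • Matrix.vecMulVec h (star h)

lemma vecMulVec_star_mul_self (h : Fin r → ℂ) :
    Matrix.vecMulVec h (star h) * Matrix.vecMulVec h (star h) =
      (normSqSum h : ℂ) • Matrix.vecMulVec h (star h) := by
  rw [Matrix.vecMulVec_mul_vecMulVec, star_dotProduct_self]
  ext i j
  simp [Matrix.vecMulVec_apply]
  ring

/-- Sherman–Morrison: the coefficient `c = γ / (1 + γ ‖h‖²)` solves `γ - c - c γ ‖h‖² = 0`. -/
lemma rankOneResolvent_mul {γ : ℝ} (hγ : 0 ≤ γ) (h : Fin r → ℂ) :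
    rankOneResolvent γ h * (1 + (γ : ℂ) • Matrix.vecMulVec h (star h)) = 1 := by
  have hs := normSqSum_nonneg h
  have h1 : 0 < 1 + γ * normSqSum h := by positivity
  have hc : (γ : ℂ) - ((γ / (1 + γ * normSqSum h) : ℝ) : ℂ) -
      ((γ / (1 + γ * normSqSum h) : ℝ) : ℂ) * γ * normSqSum h = 0 := by
    norm_cast
    field_simp
    ring
  rw [rankOneResolvent, sub_mul, one_mul, mul_add, mul_one, Matrix.smul_mul, Matrix.mul_smul,
    vecMulVec_star_mul_self, smul_smul, smul_smul, add_sub_assoc, ← sub_sub, ← sub_smul, ← sub_smul]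
  rw [hc, zero_smul, add_zero]

lemma inv_one_add_smul_vecMulVec {γ : ℝ} (hγ : 0 ≤ γ) (h : Fin r → ℂ) :
    (1 + (γ : ℂ) • Matrix.vecMulVec h (star h))⁻¹ = rankOneResolvent γ h :=
  Matrix.inv_eq_left_inv (rankOneResolvent_mul hγ h)

lemma norm_mul_norm_le_normSqSum (h : Fin r → ℂ) (i j : Fin r) :
    ‖h i‖ * ‖h j‖ ≤ normSqSum h := by
  have h1 := Finset.single_le_sum (f := fun i => ‖h i‖ ^ 2) (fun _ _ => by positivity)
    (Finset.mem_univ i)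
  have h2 := Finset.single_le_sum (f := fun i => ‖h i‖ ^ 2) (fun _ _ => by positivity)
    (Finset.mem_univ j)
  unfold normSqSum
  nlinarith [sq_nonneg (‖h i‖ - ‖h j‖)]

/-- A crude bound, but uniform in `h`: integrability of `beamPair` then needs only second moments.
-/
lemma norm_rankOneResolvent_le {γ : ℝ} (hγ : 0 ≤ γ) (h : Fin r → ℂ) (i j : Fin r) :
    ‖rankOneResolvent γ h i j‖ ≤ 2 := by
  have hs := normSqSum_nonneg h
  have h1 : 0 < 1 + γ * normSqSum h := by positivity
  have h2 : ‖(1 : Matrix (Fin r) (Fin r) ℂ) i j‖ ≤ 1 := by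
    rw [Matrix.one_apply]; split_ifs <;> simp
  have h3 : ‖((γ / (1 + γ * normSqSum h) : ℝ) : ℂ) * (h i * star (h j))‖ ≤ 1 := by
    rw [norm_mul, norm_mul, norm_star, Complex.norm_real, Real.norm_of_nonneg (by positivity),
      div_mul_eq_mul_div, div_le_one h1]
    nlinarith [mul_le_mul_of_nonneg_left (norm_mul_norm_le_normSqSum h i j) hγ]
  calc _ = ‖(1 : Matrix (Fin r) (Fin r) ℂ) i j -
        ((γ / (1 + γ * normSqSum h) : ℝ) : ℂ) * (h i * star (h j))‖ := rfl
    _ ≤ _ := norm_sub_le _ _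
    _ ≤ _ := by linarith

/-- Factor the rank-two perturbation as `U * V`; `det (1 + U V) = det (1 + V U)` leaves a
determinant of size two, built from the Gram matrix of `h` and `g`. -/
lemma det_one_add_smul_vecMulVec_add (h g : Fin r → ℂ) (p q : ℝ) :
    (1 + ((p : ℂ) • Matrix.vecMulVec h (star h) + (q : ℂ) • Matrix.vecMulVec g (star g))).det =
      (((1 + p * normSqSum h) * (1 + q * normSqSum g) - p * q * ‖star h ⬝ᵥ g‖ ^ 2 : ℝ) : ℂ) := by
  let U : Matrix (Fin r) (Fin 2) ℂ := Matrix.of fun i m => if m = 0 then p * h i else q * g i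
  let V : Matrix (Fin 2) (Fin r) ℂ := Matrix.of fun m j => if m = 0 then star (h j) else star (g j)
  have hUV : (p : ℂ) • Matrix.vecMulVec h (star h) + (q : ℂ) • Matrix.vecMulVec g (star g)
      = U * V := by
    ext i j
    simp [U, V, Matrix.mul_apply, Fin.sum_univ_two, Matrix.vecMulVec_apply, mul_assoc]
  have h00 : (V * U) 0 0 = p * (normSqSum h : ℂ) := by
    rw [← star_dotProduct_self, dotProduct, Finset.mul_sum, Matrix.mul_apply]
    exact Finset.sum_congr rfl fun i _ => by simp [U, V]; ring
  have h11 : (V * U) 1 1 = q * (normSqSum g : ℂ) := by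
    rw [← star_dotProduct_self, dotProduct, Finset.mul_sum, Matrix.mul_apply]
    exact Finset.sum_congr rfl fun i _ => by simp [U, V]; ring
  have h01 : (V * U) 0 1 = q * (star h ⬝ᵥ g) := by
    rw [dotProduct, Finset.mul_sum, Matrix.mul_apply]
    exact Finset.sum_congr rfl fun i _ => by simp [U, V]; ring
  have h10 : (V * U) 1 0 = p * star (star h ⬝ᵥ g) := by
    rw [dotProduct, star_sum, Finset.mul_sum, Matrix.mul_apply]
    exact Finset.sum_congr rfl fun i _ => by simp [U, V]; ring
  rw [hUV, Matrix.det_one_add_mul_comm, Matrix.det_fin_two]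
  simp only [Matrix.add_apply, h00, h11, h01, h10, Matrix.one_apply_eq, ne_eq, zero_ne_one,
    one_ne_zero, not_false_eq_true, Matrix.one_apply_ne]
  push_cast
  rw [← Complex.mul_conj']
  simp only [Complex.star_def]
  ring

/-- The entry `h_lᴴ (1 + γ h_z h_zᴴ)⁻¹ h_k`, where `h_k` is the `k`-th column of `H`. -/
def beamPair (γ : ℝ) (H : Matrix (Fin r) (Fin t) ℂ) (z k l : Fin t) : ℂ :=
  ∑ i, ∑ j, rankOneResolvent γ (fun m => H m z) i j * (H j k * star (H i l))

lemma trace_rankOneResolvent_mul (γ : ℝ) (H : Matrix (Fin r) (Fin t) ℂ)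
    (Q : Matrix (Fin t) (Fin t) ℂ) (z : Fin t) :
    (rankOneResolvent γ (fun m => H m z) * (H * Q * Hᴴ)).trace =
      ∑ k, ∑ l, Q k l * beamPair γ H z k l := by
  simp only [Matrix.trace, Matrix.diag_apply, Matrix.mul_apply, beamPair, Finset.mul_sum,
    Finset.sum_mul, Matrix.conjTranspose_apply]
  have h1 : ∀ i : Fin r, ∑ j, ∑ l : Fin t, ∑ k : Fin t,
      rankOneResolvent γ (fun m => H m z) i j * (H j k * Q k l * star (H i l)) =
      ∑ k, ∑ l, ∑ j,
      Q k l * (rankOneResolvent γ (fun m => H m z) i j * (H j k * star (H i l))) := fun i => by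
    rw [Finset.sum_comm, Finset.sum_congr rfl fun l _ => Finset.sum_comm, Finset.sum_comm]
    refine Finset.sum_congr rfl fun k _ => Finset.sum_congr rfl fun l _ =>
      Finset.sum_congr rfl fun j _ => by ring
  rw [Finset.sum_congr rfl fun i _ => h1 i, Finset.sum_comm]
  refine Finset.sum_congr rfl fun k _ => ?_
  rw [Finset.sum_comm]

/-- Besides the explicit value, this shows that diagonal pairings are real. -/
lemma beamPair_eq (γ : ℝ) (H : Matrix (Fin r) (Fin t) ℂ) (z k : Fin t) :
    beamPair γ H z k k = ((normSqSum (fun m => H m k) - γ *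
      ‖star (fun m => H m z) ⬝ᵥ (fun m => H m k)‖ ^ 2 /
        (1 + γ * normSqSum (fun m => H m z)) : ℝ) : ℂ) := by
  have h1 : ∀ i j, rankOneResolvent γ (fun m => H m z) i j * (H j k * star (H i k)) =
      (if i = j then H j k * star (H i k) else 0) -
      ((γ / (1 + γ * normSqSum (fun m => H m z)) : ℝ) : ℂ) *
        ((H i z * star (H i k)) * (star (H j z) * H j k)) := fun i j => by
    simp only [rankOneResolvent, Matrix.sub_apply, Matrix.one_apply, Matrix.smul_apply,
      Matrix.vecMulVec_apply, Pi.star_apply, smul_eq_mul]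
    split_ifs <;> ring
  simp only [beamPair, h1, Finset.sum_sub_distrib, Finset.sum_ite_eq, Finset.mem_univ, if_true,
    ← Finset.mul_sum, ← Finset.sum_mul]
  have h2 : ∑ i, H i k * star (H i k) = (normSqSum (fun m => H m k) : ℂ) := by
    rw [← star_dotProduct_self]
    exact Finset.sum_congr rfl fun i _ => mul_comm _ _
  have h3 : ∑ i, star (H i z) * H i k = star (fun m => H m z) ⬝ᵥ (fun m => H m k) := rfl
  have h4 : ∑ i, H i z * star (H i k) = star (star (fun m => H m z) ⬝ᵥ (fun m => H m k)) := by
    rw [← h3, star_sum]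
    exact Finset.sum_congr rfl fun i _ => by simp [mul_comm]
  rw [h2, h3, h4]
  push_cast
  rw [← Complex.conj_mul']
  simp only [Complex.star_def]
  ring

lemma beamPair_self {γ : ℝ} (hγ : 0 ≤ γ) (H : Matrix (Fin r) (Fin t) ℂ) (z : Fin t) :
    beamPair γ H z z z = ((normSqSum (fun m => H m z) /
      (1 + γ * normSqSum (fun m => H m z)) : ℝ) : ℂ) := by
  have hs := normSqSum_nonneg fun m => H m z
  have h1 : 0 < 1 + γ * normSqSum (fun m => H m z) := by positivity
  rw [beamPair_eq, star_dotProduct_self, Complex.norm_real, Real.norm_of_nonneg hs]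
  congr 1
  field_simp
  ring

lemma mul_single_mul_conjTranspose (H : Matrix (Fin r) (Fin t) ℂ) (k : Fin t) :
    H * Matrix.single k k (1 : ℂ) * Hᴴ =
      Matrix.vecMulVec (fun m => H m k) (star fun m => H m k) := by
  ext i j
  simp [Matrix.mul_apply, Matrix.single_apply, Matrix.vecMulVec_apply, ite_and]

lemma posSemidef_single (k : Fin t) : (Matrix.single k k (1 : ℂ)).PosSemidef := by
  have h := Matrix.posSemidef_vecMulVec_self_star (Pi.single k (1 : ℂ) : Fin t → ℂ)
  rwa [← Pi.single_star, star_one, ← Matrix.single_eq_single_vecMulVec_single] at h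

end RankOne

/-! ### The Kronecker channel and the mean gradient at the beam. -/

section

variable {r t : ℕ}

lemma cfc_sqrt_diagonal {n : ℕ} {d : Fin n → ℝ} (hd : ∀ i, 0 ≤ d i) :
    CFC.sqrt (Matrix.diagonal fun i => (d i : ℂ)) =
      Matrix.diagonal fun i => ((√(d i) : ℝ) : ℂ) := by
  refine CFC.sqrt_unique ?_ ?_
  · rw [Matrix.diagonal_mul_diagonal]
    congr 1; ext i
    rw [← Complex.ofReal_mul, Real.mul_self_sqrt (hd i)]
  · rw [Matrix.nonneg_iff_posSemidef, Matrix.posSemidef_diagonal_iff]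
    intro i
    exact Complex.zero_le_real.2 (Real.sqrt_nonneg _)

/-- The channel matrix `R^{1/2} G T^{1/2}` for diagonal `R` and `T`. -/
def channel (ρ : Fin r → ℝ) (τ : Fin t → ℝ) (G : Matrix (Fin r) (Fin t) ℂ) :
    Matrix (Fin r) (Fin t) ℂ :=
  fun i k => ((√(ρ i) : ℝ) : ℂ) * G i k * ((√(τ k) : ℝ) : ℂ)

lemma continuous_channel (ρ : Fin r → ℝ) (τ : Fin t → ℝ) : Continuous (channel ρ τ) :=
  continuous_matrix fun i k =>
    (continuous_const.mul (continuous_entry i k)).mul continuous_const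

lemma kroneckerRayleigh_diagonal {ρ : Fin r → ℝ} {τ : Fin t → ℝ} (hρ : ∀ i, 0 < ρ i)
    (hτ : ∀ k, 0 ≤ τ k) :
    kroneckerRayleigh (Matrix.diagonal fun i => (ρ i : ℂ)) (Matrix.diagonal fun k => (τ k : ℂ)) =
      (stdGaussianMatrix r t).map (channel ρ τ) := by
  rw [kroneckerRayleigh, cfc_sqrt_diagonal fun i => (hρ i).le, cfc_sqrt_diagonal hτ]
  congr 1
  ext G i k
  rw [Matrix.mul_diagonal, Matrix.diagonal_mul, channel]

lemma continuous_det_rate (γ : ℝ) (Q : Matrix (Fin t) (Fin t) ℂ) :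
    Continuous fun H : Matrix (Fin r) (Fin t) ℂ =>
      (1 + (γ : ℂ) • (H * Q * Hᴴ)).det.re :=
  Complex.continuous_re.comp (Continuous.matrix_det (by fun_prop))

lemma measurable_log_det (γ : ℝ) (Q : Matrix (Fin t) (Fin t) ℂ) :
    Measurable fun H : Matrix (Fin r) (Fin t) ℂ =>
      Real.log (1 + (γ : ℂ) • (H * Q * Hᴴ)).det.re :=
  Real.measurable_log.comp (continuous_det_rate γ Q).measurable

lemma ergodicRate_kroneckerRayleigh {ρ : Fin r → ℝ} {τ : Fin t → ℝ} (hρ : ∀ i, 0 < ρ i)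
    (hτ : ∀ k, 0 ≤ τ k) (γ : ℝ) (Q : Matrix (Fin t) (Fin t) ℂ) :
    ergodicRate γ (kroneckerRayleigh (Matrix.diagonal fun i => (ρ i : ℂ))
      (Matrix.diagonal fun k => (τ k : ℂ))) Q =
      ∫ G, Real.log (1 + (γ : ℂ) • (channel ρ τ G * Q * (channel ρ τ G)ᴴ)).det.re
        ∂stdGaussianMatrix r t := by
  rw [kroneckerRayleigh_diagonal hρ hτ, ergodicRate, integral_map
    (continuous_channel ρ τ).measurable.aemeasurable
    (measurable_log_det γ Q).aestronglyMeasurable]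

lemma norm_channel_sq {ρ : Fin r → ℝ} {τ : Fin t → ℝ} (hρ : ∀ i, 0 < ρ i)
    (hτ : ∀ k, 0 ≤ τ k) (G : Matrix (Fin r) (Fin t) ℂ) (i : Fin r) (k : Fin t) :
    ‖channel ρ τ G i k‖ ^ 2 = ρ i * τ k * ‖G i k‖ ^ 2 := by
  rw [channel, norm_mul, norm_mul, Complex.norm_real, Complex.norm_real,
    Real.norm_of_nonneg (Real.sqrt_nonneg _), Real.norm_of_nonneg (Real.sqrt_nonneg _),
    mul_pow, mul_pow, Real.sq_sqrt (hρ i).le, Real.sq_sqrt (hτ k)]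
  ring

lemma mul_normSqSum_channel {ρ : Fin r → ℝ} {τ : Fin t → ℝ} (hρ : ∀ i, 0 < ρ i)
    (hτ : ∀ k, 0 ≤ τ k) (γ : ℝ) (G : Matrix (Fin r) (Fin t) ℂ) (k : Fin t) :
    γ * normSqSum (fun m => channel ρ τ G m k) = beamGain (γ * τ k) ρ k G := by
  simp only [normSqSum, norm_channel_sq hρ hτ, beamGain, Finset.mul_sum]
  exact Finset.sum_congr rfl fun i _ => by ring

lemma integrable_norm_channel_sq {ρ : Fin r → ℝ} {τ : Fin t → ℝ} (hρ : ∀ i, 0 < ρ i)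
    (hτ : ∀ k, 0 ≤ τ k) (i : Fin r) (k : Fin t) :
    Integrable (fun G => ‖channel ρ τ G i k‖ ^ 2) (stdGaussianMatrix r t) := by
  simp_rw [norm_channel_sq hρ hτ]
  exact (integrable_norm_sq_entry i k).const_mul _

lemma integrable_normSqSum_channel {ρ : Fin r → ℝ} {τ : Fin t → ℝ} (hρ : ∀ i, 0 < ρ i)
    (hτ : ∀ k, 0 ≤ τ k) (k : Fin t) :
    Integrable (fun G => normSqSum fun m => channel ρ τ G m k) (stdGaussianMatrix r t) :=
  integrable_finsetSum _ fun i _ => integrable_norm_channel_sq hρ hτ i k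

lemma continuous_normSqSum_column (k : Fin t) :
    Continuous fun H : Matrix (Fin r) (Fin t) ℂ => normSqSum fun m => H m k :=
  continuous_finsetSum _ fun j _ => (continuous_entry j k).norm.pow 2

lemma continuous_rankOneResolvent {γ : ℝ} (hγ : 0 ≤ γ) (z : Fin t) (i j : Fin r) :
    Continuous fun H : Matrix (Fin r) (Fin t) ℂ =>
      rankOneResolvent γ (fun m => H m z) i j := by
  have h0 : ∀ H : Matrix (Fin r) (Fin t) ℂ, 1 + γ * normSqSum (fun m => H m z) ≠ 0 := fun H => by
    have := normSqSum_nonneg fun m => H m z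
    positivity
  have h1 := continuous_normSqSum_column (r := r) z
  have h2 : Continuous fun H : Matrix (Fin r) (Fin t) ℂ =>
      γ / (1 + γ * normSqSum (fun m => H m z)) :=
    continuous_const.div (by fun_prop) h0
  exact continuous_const.sub ((Complex.continuous_ofReal.comp h2).mul
    ((continuous_entry i z).mul (continuous_entry j z).star))

lemma integrable_beamPair_term {γ : ℝ} (hγ : 0 ≤ γ) {ρ : Fin r → ℝ} {τ : Fin t → ℝ}
    (hρ : ∀ i, 0 < ρ i) (hτ : ∀ k, 0 ≤ τ k) (z k l : Fin t) (i j : Fin r) :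
    Integrable (fun G => rankOneResolvent γ (fun m => channel ρ τ G m z) i j *
      (channel ρ τ G j k * star (channel ρ τ G i l))) (stdGaussianMatrix r t) := by
  refine ((integrable_norm_channel_sq hρ hτ j k).add
    (integrable_norm_channel_sq hρ hτ i l)).mono' ?_ (.of_forall fun G => ?_)
  · have h1 : Continuous fun H : Matrix (Fin r) (Fin t) ℂ =>
        rankOneResolvent γ (fun m => H m z) i j * (H j k * star (H i l)) :=
      (continuous_rankOneResolvent hγ z i j).mul
        ((continuous_entry j k).mul (continuous_entry i l).star)
    exact (h1.comp (continuous_channel ρ τ)).measurable.aestronglyMeasurable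
  · have h1 := norm_rankOneResolvent_le hγ (fun m => channel ρ τ G m z) i j
    rw [norm_mul, norm_mul, norm_star]
    refine (mul_le_mul_of_nonneg_right h1 (by positivity)).trans ?_
    have := sq_nonneg (‖channel ρ τ G j k‖ - ‖channel ρ τ G i l‖)
    simp only [Pi.add_apply]
    nlinarith

lemma integrable_beamPair {γ : ℝ} (hγ : 0 ≤ γ) {ρ : Fin r → ℝ} {τ : Fin t → ℝ}
    (hρ : ∀ i, 0 < ρ i) (hτ : ∀ k, 0 ≤ τ k) (z k l : Fin t) :
    Integrable (fun G => beamPair γ (channel ρ τ G) z k l) (stdGaussianMatrix r t) :=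
  integrable_finsetSum _ fun i _ => integrable_finsetSum _ fun j _ =>
    integrable_beamPair_term hγ hρ hτ z k l i j

lemma integral_beamPair_eq_sum {γ : ℝ} (hγ : 0 ≤ γ) {ρ : Fin r → ℝ} {τ : Fin t → ℝ}
    (hρ : ∀ i, 0 < ρ i) (hτ : ∀ k, 0 ≤ τ k) (z k l : Fin t) :
    ∫ G, beamPair γ (channel ρ τ G) z k l ∂stdGaussianMatrix r t =
      ∑ i, ∑ j, ∫ G, rankOneResolvent γ (fun m => channel ρ τ G m z) i j *
        (channel ρ τ G j k * star (channel ρ τ G i l)) ∂stdGaussianMatrix r t := by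
  unfold beamPair
  rw [integral_finsetSum _ fun i _ => integrable_finsetSum _ fun j _ =>
    integrable_beamPair_term hγ hρ hτ z k l i j]
  exact Finset.sum_congr rfl fun i _ => integral_finsetSum _ fun j _ =>
    integrable_beamPair_term hγ hρ hτ z k l i j

lemma channel_negEntry_of_ne (ρ : Fin r → ℝ) (τ : Fin t → ℝ) (G : Matrix (Fin r) (Fin t) ℂ)
    {i j : Fin r} {k l : Fin t} (h : ¬(j = i ∧ l = k)) :
    channel ρ τ (negEntry i k G) j l = channel ρ τ G j l := by
  simp only [channel, negEntry, if_neg h]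

lemma channel_negEntry_self (ρ : Fin r → ℝ) (τ : Fin t → ℝ) (G : Matrix (Fin r) (Fin t) ℂ)
    (i : Fin r) (k : Fin t) :
    channel ρ τ (negEntry i k G) i k = -channel ρ τ G i k := by
  simp [channel, negEntry]

/-- The resolvent depends on column `z` only. An entry outside that column, different from the other
entry in the product, therefore occurs in exactly one factor, and flipping its sign negates the
integrand. -/
lemma integral_beamPair_term_eq_zero (γ : ℝ) (ρ : Fin r → ℝ) (τ : Fin t → ℝ) {z k l : Fin t}
    {i j : Fin r} (hz : k ≠ z ∨ l ≠ z) (hne : ¬(j = i ∧ k = l)) :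
    ∫ G, rankOneResolvent γ (fun m => channel ρ τ G m z) i j *
        (channel ρ τ G j k * star (channel ρ τ G i l)) ∂stdGaussianMatrix r t = 0 := by
  rcases hz with hz | hz
  · refine integral_eq_zero_of_negEntry j k fun G => ?_
    have h1 : (fun m => channel ρ τ (negEntry j k G) m z) = fun m => channel ρ τ G m z :=
      funext fun m => channel_negEntry_of_ne ρ τ G fun h => hz h.2.symm
    rw [h1, channel_negEntry_self,
      channel_negEntry_of_ne ρ τ G fun h => hne ⟨h.1.symm, h.2.symm⟩]
    ring
  · refine integral_eq_zero_of_negEntry i l fun G => ?_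
    have h1 : (fun m => channel ρ τ (negEntry i l G) m z) = fun m => channel ρ τ G m z :=
      funext fun m => channel_negEntry_of_ne ρ τ G fun h => hz h.2.symm
    rw [h1, channel_negEntry_self, channel_negEntry_of_ne ρ τ G hne, star_neg]
    ring

lemma integral_beamPair_of_ne {γ : ℝ} (hγ : 0 ≤ γ) {ρ : Fin r → ℝ} {τ : Fin t → ℝ}
    (hρ : ∀ i, 0 < ρ i) (hτ : ∀ k, 0 ≤ τ k) (z : Fin t) {k l : Fin t} (hkl : k ≠ l) :
    ∫ G, beamPair γ (channel ρ τ G) z k l ∂stdGaussianMatrix r t = 0 := by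
  rw [integral_beamPair_eq_sum hγ hρ hτ]
  refine Finset.sum_eq_zero fun i _ => Finset.sum_eq_zero fun j _ =>
    integral_beamPair_term_eq_zero γ ρ τ ?_ fun h => hkl h.2
  by_contra! h
  exact hkl (h.1.trans h.2.symm)

lemma mul_norm_sq_div_le {a : ℝ} (ha : 0 ≤ a) {ρ : Fin r → ℝ} (hρ : ∀ i, 0 < ρ i) (z : Fin t)
    (G : Matrix (Fin r) (Fin t) ℂ) (i : Fin r) :
    ρ i * (a * ‖G i z‖ ^ 2 / (1 + beamGain a ρ z G)) ≤ 1 := by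
  have hS := beamGain_nonneg ha hρ z G
  have h := Finset.single_le_sum (f := fun j => a * ρ j * ‖G j z‖ ^ 2)
    (fun j _ => mul_nonneg (mul_nonneg ha (hρ j).le) (by positivity)) (Finset.mem_univ i)
  change _ ≤ beamGain a ρ z G at h
  rw [mul_div_assoc', div_le_one (by linarith)]
  linarith

lemma integrable_beamMean {a : ℝ} (ha : 0 ≤ a) {ρ : Fin r → ℝ} (hρ : ∀ i, 0 < ρ i) (z : Fin t)
    (i : Fin r) :
    Integrable (fun G => a * ‖G i z‖ ^ 2 / (1 + beamGain a ρ z G)) (stdGaussianMatrix r t) := by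
  refine (integrable_const (ρ i)⁻¹).mono' ?_ (.of_forall fun G => ?_)
  · refine Measurable.aestronglyMeasurable (Measurable.div ?_ ?_)
    · exact ((measurable_entry i z).norm.pow_const 2).const_mul a
    · exact (continuous_beamGain a ρ z).measurable.const_add 1
  · have hS := beamGain_nonneg ha hρ z G
    rw [Real.norm_of_nonneg (by positivity)]
    rw [← mul_le_mul_iff_right₀ (hρ i), mul_inv_cancel₀ (hρ i).ne']
    exact mul_norm_sq_div_le ha hρ z G i

lemma mul_beamMean_le_one {a : ℝ} (ha : 0 ≤ a) {ρ : Fin r → ℝ} (hρ : ∀ i, 0 < ρ i) (z : Fin t)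
    (i : Fin r) : ρ i * beamMean a ρ z i ≤ 1 := by
  rw [beamMean, ← integral_const_mul]
  have h := integral_mono ((integrable_beamMean ha hρ z i).const_mul (ρ i))
    (integrable_const (1 : ℝ)) fun G => mul_norm_sq_div_le ha hρ z G i
  simpa using h

lemma beamMean_nonneg {a : ℝ} (ha : 0 ≤ a) {ρ : Fin r → ℝ} (hρ : ∀ i, 0 < ρ i) (z : Fin t)
    (i : Fin r) : 0 ≤ beamMean a ρ z i :=
  integral_nonneg fun G => by
    have hS := beamGain_nonneg ha hρ z G
    positivity

lemma rankOneResolvent_channel_diag {γ : ℝ} {ρ : Fin r → ℝ} {τ : Fin t → ℝ}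
    (hρ : ∀ i, 0 < ρ i) (hτ : ∀ k, 0 ≤ τ k) (z : Fin t) (G : Matrix (Fin r) (Fin t) ℂ)
    (i : Fin r) :
    rankOneResolvent γ (fun m => channel ρ τ G m z) i i =
      ((1 - ρ i * (γ * τ z * ‖G i z‖ ^ 2 / (1 + beamGain (γ * τ z) ρ z G)) : ℝ) : ℂ) := by
  have h2 : channel ρ τ G i z * star (channel ρ τ G i z) =
      ((ρ i * τ z * ‖G i z‖ ^ 2 : ℝ) : ℂ) := by
    rw [← norm_channel_sq hρ hτ, Complex.star_def, Complex.mul_conj', Complex.ofReal_pow]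
  have h3 : rankOneResolvent γ (fun m => channel ρ τ G m z) i i =
      1 - ((γ / (1 + γ * normSqSum fun m => channel ρ τ G m z) : ℝ) : ℂ) *
        (channel ρ τ G i z * star (channel ρ τ G i z)) := by
    simp [rankOneResolvent, Matrix.vecMulVec_apply]
  rw [h3, h2, mul_normSqSum_channel hρ hτ]
  push_cast
  ring

/-- Only the terms `i = j` survive the sign symmetry. In these, column `k` averages out by
independence, leaving the mean diagonal of the resolvent weighted by `ρ_i τ_k`. -/
lemma integral_beamPair_of_ne_beam {γ : ℝ} (hγ : 0 ≤ γ) {ρ : Fin r → ℝ} {τ : Fin t → ℝ}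
    (hρ : ∀ i, 0 < ρ i) (hτ : ∀ k, 0 ≤ τ k) {z k : Fin t} (hk : k ≠ z) :
    ∫ G, beamPair γ (channel ρ τ G) z k k ∂stdGaussianMatrix r t =
      ((τ k * ∑ i, ρ i * (1 - ρ i * beamMean (γ * τ z) ρ z i) : ℝ) : ℂ) := by
  have ha : 0 ≤ γ * τ z := mul_nonneg hγ (hτ z)
  rw [integral_beamPair_eq_sum hγ hρ hτ, Finset.mul_sum, Complex.ofReal_sum]
  refine Finset.sum_congr rfl fun i _ => ?_
  rw [Finset.sum_eq_single i
    (fun j _ hj => integral_beamPair_term_eq_zero γ ρ τ (Or.inl hk) fun h => hj h.1)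
    (fun h => absurd (Finset.mem_univ i) h)]
  have h1 : ∀ G : Matrix (Fin r) (Fin t) ℂ,
      rankOneResolvent γ (fun m => channel ρ τ G m z) i i *
        (channel ρ τ G i k * star (channel ρ τ G i k)) =
      ((ρ i * τ k * (‖G i k‖ ^ 2 * (1 - ρ i * (γ * τ z * ‖G i z‖ ^ 2 /
        (1 + beamGain (γ * τ z) ρ z G)))) : ℝ) : ℂ) := fun G => by
    rw [rankOneResolvent_channel_diag hρ hτ, Complex.star_def, Complex.mul_conj',
      ← Complex.ofReal_pow, norm_channel_sq hρ hτ]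
    push_cast
    ring
  simp_rw [h1]
  rw [integral_complex_ofReal, integral_const_mul]
  have h2 := integral_norm_sq_entry_mul (r := r) hk i (φ := fun x => 1 - ρ i *
    (γ * τ z * ‖x i‖ ^ 2 / (1 + ∑ j, γ * τ z * ρ j * ‖x j‖ ^ 2))) (by fun_prop)
  have h3 : ∫ G, ‖G i k‖ ^ 2 * (1 - ρ i * (γ * τ z * ‖G i z‖ ^ 2 /
        (1 + beamGain (γ * τ z) ρ z G))) ∂stdGaussianMatrix r t =
      1 - ρ i * beamMean (γ * τ z) ρ z i := by
    refine h2.trans ?_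
    rw [beamMean, ← integral_const_mul]
    have h4 := integral_sub (μ := stdGaussianMatrix r t) (integrable_const (1 : ℝ))
      ((integrable_beamMean ha hρ z i).const_mul (ρ i))
    simpa [beamGain] using h4
  rw [h3]
  congr 1
  ring

/-- The integrand is `S / (1 + S)` with `S` the gain of column `z`; it splits into the shares of the
receive antennas. -/
lemma mul_integral_beamPair_beam {γ : ℝ} (hγ : 0 ≤ γ) {ρ : Fin r → ℝ} {τ : Fin t → ℝ}
    (hρ : ∀ i, 0 < ρ i) (hτ : ∀ k, 0 ≤ τ k) (z : Fin t) :
    γ * ∫ G, beamPair γ (channel ρ τ G) z z z ∂stdGaussianMatrix r t =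
      ((∑ i, ρ i * beamMean (γ * τ z) ρ z i : ℝ) : ℂ) := by
  have ha : 0 ≤ γ * τ z := mul_nonneg hγ (hτ z)
  have h1 : ∀ G : Matrix (Fin r) (Fin t) ℂ, (γ : ℂ) * beamPair γ (channel ρ τ G) z z z =
      ((∑ i, ρ i * (γ * τ z * ‖G i z‖ ^ 2 / (1 + beamGain (γ * τ z) ρ z G)) : ℝ) : ℂ) :=
    fun G => by
    rw [beamPair_self hγ, ← Complex.ofReal_mul, ← mul_div_assoc, mul_normSqSum_channel hρ hτ]
    congr 1
    conv_lhs => rw [beamGain]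
    rw [Finset.sum_div]
    exact Finset.sum_congr rfl fun i _ => by rw [← beamGain]; ring
  rw [← integral_const_mul]
  simp_rw [h1]
  rw [integral_complex_ofReal, integral_finsetSum _ fun i _ =>
    (integrable_beamMean ha hρ z i).const_mul _]
  simp_rw [integral_const_mul]
  rfl

end

/-! ### The first-order condition: sufficiency and necessity. -/

section

variable {r t : ℕ}

lemma posSemidef_smul_mul_mul {γ : ℝ} (hγ : 0 ≤ γ) (H : Matrix (Fin r) (Fin t) ℂ)
    {Q : Matrix (Fin t) (Fin t) ℂ} (hQ : Q.PosSemidef) :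
    ((γ : ℂ) • (H * Q * Hᴴ)).PosSemidef :=
  (hQ.mul_mul_conjTranspose_same H).smul (Complex.zero_le_real.2 hγ)

lemma log_det_rate_nonneg {γ : ℝ} (hγ : 0 ≤ γ) (H : Matrix (Fin r) (Fin t) ℂ)
    {Q : Matrix (Fin t) (Fin t) ℂ} (hQ : Q.PosSemidef) :
    0 ≤ Real.log (1 + (γ : ℂ) • (H * Q * Hᴴ)).det.re :=
  log_det_one_add_nonneg (posSemidef_smul_mul_mul hγ H hQ)

/-- The rate is bounded by its linearisation at the beamforming covariance. -/
lemma log_det_rate_le {γ : ℝ} (hγ : 0 ≤ γ) (H : Matrix (Fin r) (Fin t) ℂ)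
    {Q : Matrix (Fin t) (Fin t) ℂ} (hQ : Q.PosSemidef) (z : Fin t) :
    Real.log (1 + (γ : ℂ) • (H * Q * Hᴴ)).det.re ≤
      Real.log (1 + (γ : ℂ) • (H * Matrix.single z z (1 : ℂ) * Hᴴ)).det.re +
        (γ * (∑ k, ∑ l, Q k l * beamPair γ H z k l - beamPair γ H z z z)).re := by
  have hA := Matrix.PosDef.one.add_posSemidef
    (posSemidef_smul_mul_mul hγ H (posSemidef_single z))
  have hM := Matrix.PosDef.one.add_posSemidef (posSemidef_smul_mul_mul hγ H hQ)
  have h := log_det_le hA hM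
  have hinv : (1 + (γ : ℂ) • (H * Matrix.single z z (1 : ℂ) * Hᴴ))⁻¹ =
      rankOneResolvent γ (fun m => H m z) := by
    rw [mul_single_mul_conjTranspose, inv_one_add_smul_vecMulVec hγ]
  -- The trace of this identity expresses the trace of the resolvent as `r - γ * beamPair γ H z z
  -- z`, which cancels the dimension in the tangent inequality.
  have h1 := congrArg Matrix.trace (rankOneResolvent_mul hγ fun m => H m z)
  have hsingle : (rankOneResolvent γ (fun m => H m z) *
      Matrix.vecMulVec (fun m => H m z) (star fun m => H m z)).trace = beamPair γ H z z z := by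
    rw [← mul_single_mul_conjTranspose, trace_rankOneResolvent_mul]
    simp [Matrix.single_apply, ite_and]
  rw [mul_add, mul_one, Matrix.trace_add, Matrix.mul_smul, Matrix.trace_smul, hsingle,
    Matrix.trace_one, Fintype.card_fin, smul_eq_mul] at h1
  have h2 : ((1 + (γ : ℂ) • (H * Matrix.single z z (1 : ℂ) * Hᴴ))⁻¹ *
      (1 + (γ : ℂ) • (H * Q * Hᴴ))).trace = r +
        γ * (∑ k, ∑ l, Q k l * beamPair γ H z k l - beamPair γ H z z z) := by
    rw [hinv, mul_add, mul_one, Matrix.trace_add, Matrix.mul_smul, Matrix.trace_smul,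
      trace_rankOneResolvent_mul, smul_eq_mul]
    linear_combination h1
  rw [h2, Fintype.card_fin, Complex.add_re, Complex.natCast_re] at h
  linarith

lemma re_det_beam (γ : ℝ) (H : Matrix (Fin r) (Fin t) ℂ) (z : Fin t) :
    (1 + (γ : ℂ) • (H * Matrix.single z z (1 : ℂ) * Hᴴ)).det.re =
      1 + γ * normSqSum (fun m => H m z) := by
  have h := det_one_add_smul_vecMulVec_add (fun m => H m z) (fun m => H m z) γ 0
  rw [mul_single_mul_conjTranspose]
  simp only [Complex.ofReal_zero, zero_smul, add_zero] at h
  rw [h, Complex.ofReal_re]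
  ring

lemma integrable_log_det_beam {γ : ℝ} (hγ : 0 ≤ γ) {ρ : Fin r → ℝ} {τ : Fin t → ℝ}
    (hρ : ∀ i, 0 < ρ i) (hτ : ∀ k, 0 ≤ τ k) (z : Fin t) :
    Integrable (fun G => Real.log (1 + (γ : ℂ) •
      (channel ρ τ G * Matrix.single z z (1 : ℂ) * (channel ρ τ G)ᴴ)).det.re)
      (stdGaussianMatrix r t) := by
  refine ((integrable_normSqSum_channel hρ hτ z).const_mul γ).mono'
    ((measurable_log_det γ _).comp (continuous_channel ρ τ).measurable).aestronglyMeasurable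
    (.of_forall fun G => ?_)
  rw [Real.norm_of_nonneg (log_det_rate_nonneg hγ _ (posSemidef_single z)), re_det_beam]
  have hs := normSqSum_nonneg fun m => channel ρ τ G m z
  have := Real.log_le_sub_one_of_pos
    (by positivity : 0 < 1 + γ * normSqSum fun m => channel ρ τ G m z)
  linarith

lemma integrable_linearisation {γ : ℝ} (hγ : 0 ≤ γ) {ρ : Fin r → ℝ} {τ : Fin t → ℝ}
    (hρ : ∀ i, 0 < ρ i) (hτ : ∀ k, 0 ≤ τ k) (z : Fin t) (Q : Matrix (Fin t) (Fin t) ℂ) :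
    Integrable (fun G => γ * (∑ k, ∑ l, Q k l * beamPair γ (channel ρ τ G) z k l -
      beamPair γ (channel ρ τ G) z z z)) (stdGaussianMatrix r t) :=
  ((integrable_finsetSum _ fun k _ => integrable_finsetSum _ fun l _ =>
    (integrable_beamPair hγ hρ hτ z k l).const_mul (Q k l)).sub
    (integrable_beamPair hγ hρ hτ z z z)).const_mul _

/-- The integrand lies between `0` and its tangent at the beam, which is integrable. -/
lemma integrable_log_det_rate {γ : ℝ} (hγ : 0 ≤ γ) {ρ : Fin r → ℝ} {τ : Fin t → ℝ}
    (hρ : ∀ i, 0 < ρ i) (hτ : ∀ k, 0 ≤ τ k) (z : Fin t) {Q : Matrix (Fin t) (Fin t) ℂ}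
    (hQ : Q.PosSemidef) :
    Integrable (fun G => Real.log (1 + (γ : ℂ) •
      (channel ρ τ G * Q * (channel ρ τ G)ᴴ)).det.re) (stdGaussianMatrix r t) := by
  refine ((integrable_log_det_beam hγ hρ hτ z).add
    (integrable_linearisation hγ hρ hτ z Q).re).mono'
    ((measurable_log_det γ _).comp (continuous_channel ρ τ).measurable).aestronglyMeasurable
    (.of_forall fun G => ?_)
  rw [Real.norm_of_nonneg (log_det_rate_nonneg hγ _ hQ)]
  exact log_det_rate_le hγ _ hQ z

/-- Off-diagonal pairings have mean zero and diagonal ones are real, so only the real parts of the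
diagonal of `Q` contribute. -/
lemma integral_linearisation {γ : ℝ} (hγ : 0 ≤ γ) {ρ : Fin r → ℝ} {τ : Fin t → ℝ}
    (hρ : ∀ i, 0 < ρ i) (hτ : ∀ k, 0 ≤ τ k) (z : Fin t) (Q : Matrix (Fin t) (Fin t) ℂ) :
    ∫ G, (γ * (∑ k, ∑ l, Q k l * beamPair γ (channel ρ τ G) z k l -
      beamPair γ (channel ρ τ G) z z z)).re ∂stdGaussianMatrix r t =
    ∑ k, (Q k k).re * (γ * ∫ G, beamPair γ (channel ρ τ G) z k k ∂stdGaussianMatrix r t).re -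
      (γ * ∫ G, beamPair γ (channel ρ τ G) z z z ∂stdGaussianMatrix r t).re := by
  have hI := fun k l => integrable_beamPair hγ hρ hτ z k l
  have h1 := integral_re (𝕜 := ℂ) (integrable_linearisation hγ hρ hτ z Q)
  simp only [RCLike.re_eq_complex_re] at h1
  have him : ∀ k, (γ * ∫ G, beamPair γ (channel ρ τ G) z k k ∂stdGaussianMatrix r t).im = 0 := by
    intro k
    simp_rw [beamPair_eq]
    rw [integral_complex_ofReal, ← Complex.ofReal_mul, Complex.ofReal_im]
  rw [h1, integral_const_mul, integral_sub (integrable_finsetSum _ fun k _ =>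
    integrable_finsetSum _ fun l _ => (hI k l).const_mul (Q k l)) (hI z z),
    integral_finsetSum _ fun k _ => integrable_finsetSum _ fun l _ => (hI k l).const_mul (Q k l),
    mul_sub, Complex.sub_re]
  congr 1
  rw [Finset.mul_sum, Complex.re_sum]
  refine Finset.sum_congr rfl fun k _ => ?_
  rw [integral_finsetSum _ fun l _ => (hI k l).const_mul (Q k l), Finset.sum_eq_single k]
  · rw [integral_const_mul, mul_left_comm, Complex.mul_re, him, mul_zero, sub_zero]
  · intro l _ hl
    rw [integral_const_mul, integral_beamPair_of_ne hγ hρ hτ z hl.symm, mul_zero]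
  · exact fun h => absurd (Finset.mem_univ k) h

lemma single_mem_feasibleCovariances (z : Fin t) :
    Matrix.single z z (1 : ℂ) ∈ feasibleCovariances t :=
  ⟨posSemidef_single z, by simp⟩

lemma re_mul_integral_beamPair_of_ne {γ : ℝ} (hγ : 0 ≤ γ) {ρ : Fin r → ℝ} {τ : Fin t → ℝ}
    (hρ : ∀ i, 0 < ρ i) (hτ : ∀ k, 0 ≤ τ k) {z k : Fin t} (hk : k ≠ z) :
    (γ * ∫ G, beamPair γ (channel ρ τ G) z k k ∂stdGaussianMatrix r t).re =
      γ * τ k * ∑ i, ρ i * (1 - ρ i * beamMean (γ * τ z) ρ z i) := by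
  rw [integral_beamPair_of_ne_beam hγ hρ hτ hk, ← Complex.ofReal_mul, Complex.ofReal_re, mul_assoc]

lemma re_mul_integral_beamPair_beam {γ : ℝ} (hγ : 0 ≤ γ) {ρ : Fin r → ℝ} {τ : Fin t → ℝ}
    (hρ : ∀ i, 0 < ρ i) (hτ : ∀ k, 0 ≤ τ k) (z : Fin t) :
    (γ * ∫ G, beamPair γ (channel ρ τ G) z z z ∂stdGaussianMatrix r t).re =
      ∑ i, ρ i * beamMean (γ * τ z) ρ z i := by
  rw [mul_integral_beamPair_beam hγ hρ hτ, Complex.ofReal_re]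

/-- The first order condition is sufficient for the optimality of beamforming. -/
lemma isOptimalCovariance_of_le {γ : ℝ} (hγ : 0 ≤ γ) {ρ : Fin r → ℝ} {τ : Fin t → ℝ}
    (hρ : ∀ i, 0 < ρ i) (hτ : ∀ k, 0 ≤ τ k) {z o : Fin t} (ho : ∀ k, k ≠ z → τ k ≤ τ o)
    (h : γ * τ o * ∑ i, ρ i * (1 - ρ i * beamMean (γ * τ z) ρ z i) ≤
      ∑ i, ρ i * beamMean (γ * τ z) ρ z i) :
    IsOptimalCovariance γ (kroneckerRayleigh (Matrix.diagonal fun i => (ρ i : ℂ))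
      (Matrix.diagonal fun k => (τ k : ℂ))) (Matrix.single z z 1) := by
  have ha : 0 ≤ γ * τ z := mul_nonneg hγ (hτ z)
  refine ⟨single_mem_feasibleCovariances z, fun Q hQ => ?_⟩
  obtain ⟨hQ, htr⟩ := hQ
  simp only [Set.mem_ofPred_eq, ergodicRate_kroneckerRayleigh hρ hτ]
  set A := ∑ i, ρ i * beamMean (γ * τ z) ρ z i with hA
  set B := ∑ i, ρ i * (1 - ρ i * beamMean (γ * τ z) ρ z i) with hB
  have hA0 : 0 ≤ A := Finset.sum_nonneg fun i _ =>
    mul_nonneg (hρ i).le (beamMean_nonneg ha hρ z i)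
  -- Nonnegativity of `B` makes the competitor's gradient `γ τ_k B` monotone in `τ_k`, so the
  -- largest one decides.
  have hB0 : 0 ≤ B := Finset.sum_nonneg fun i _ =>
    mul_nonneg (hρ i).le (by linarith [mul_beamMean_le_one ha hρ z i])
  have hlin := integrable_linearisation hγ hρ hτ z Q
  have h1 := integral_mono (integrable_log_det_rate hγ hρ hτ z hQ)
    ((integrable_log_det_beam hγ hρ hτ z).add hlin.re)
    (fun G => log_det_rate_le hγ (channel ρ τ G) hQ z)
  have h2 := integral_add (integrable_log_det_beam hγ hρ hτ z) hlin.re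
  have h3 := integral_linearisation hγ hρ hτ z Q
  have h4 : ∀ k, (Q k k).re *
      (γ * ∫ G, beamPair γ (channel ρ τ G) z k k ∂stdGaussianMatrix r t).re ≤
      (Q k k).re * A := fun k => by
    refine mul_le_mul_of_nonneg_left ?_ (Complex.nonneg_iff.1 hQ.diag_nonneg).1
    by_cases hk : k = z
    · rw [hk, re_mul_integral_beamPair_beam hγ hρ hτ]
    · rw [re_mul_integral_beamPair_of_ne hγ hρ hτ hk]
      refine le_trans ?_ h
      exact mul_le_mul_of_nonneg_right (mul_le_mul_of_nonneg_left (ho k hk) hγ) hB0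
  have h5 := Finset.sum_le_sum fun k (_ : k ∈ Finset.univ) => h4 k
  rw [← Finset.sum_mul] at h5
  have h6 : ∑ k, (Q k k).re = Q.trace.re := by simp [Matrix.trace]
  rw [h6] at h5
  rw [re_mul_integral_beamPair_beam hγ hρ hτ] at h3
  -- The trace may be less than one; `0 ≤ A` means that unused power gains nothing.
  have h7 : Q.trace.re * A ≤ A := mul_le_of_le_one_left hA0 htr
  refine h1.trans ?_
  refine h2.trans_le ?_
  simp only [RCLike.re_eq_complex_re]
  rw [h3]
  linarith

/-- The covariance that moves the share `ε` of the power from the column `z` to the column `o`. -/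
def sharedCovariance (z o : Fin t) (ε : ℝ) : Matrix (Fin t) (Fin t) ℂ :=
  ((1 - ε : ℝ) : ℂ) • Matrix.single z z (1 : ℂ) + ((ε : ℝ) : ℂ) • Matrix.single o o (1 : ℂ)

lemma sharedCovariance_mem {ε : ℝ} (h0 : 0 ≤ ε) (h1 : ε ≤ 1) (z o : Fin t) :
    sharedCovariance z o ε ∈ feasibleCovariances t := by
  refine ⟨?_, ?_⟩
  · exact ((posSemidef_single z).smul (Complex.zero_le_real.2 (by linarith))).add
      ((posSemidef_single o).smul (Complex.zero_le_real.2 h0))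
  · simp [sharedCovariance]

lemma re_det_sharedCovariance (γ ε : ℝ) (H : Matrix (Fin r) (Fin t) ℂ) (z o : Fin t) :
    (1 + (γ : ℂ) • (H * sharedCovariance z o ε * Hᴴ)).det.re =
      (1 + γ * (1 - ε) * normSqSum (fun m => H m z)) * (1 + γ * ε * normSqSum (fun m => H m o)) -
      γ * (1 - ε) * (γ * ε) * ‖star (fun m => H m z) ⬝ᵥ (fun m => H m o)‖ ^ 2 := by
  have h : (γ : ℂ) • (H * sharedCovariance z o ε * Hᴴ) =
      ((γ * (1 - ε) : ℝ) : ℂ) • Matrix.vecMulVec (fun m => H m z) (star fun m => H m z) +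
      ((γ * ε : ℝ) : ℂ) • Matrix.vecMulVec (fun m => H m o) (star fun m => H m o) := by
    rw [← mul_single_mul_conjTranspose, ← mul_single_mul_conjTranspose, sharedCovariance,
      Matrix.mul_add, Matrix.add_mul, smul_add, Matrix.mul_smul, Matrix.mul_smul, Matrix.smul_mul,
      Matrix.smul_mul, smul_smul, smul_smul, Complex.ofReal_mul, Complex.ofReal_mul]
  rw [h, det_one_add_smul_vecMulVec_add, Complex.ofReal_re]

/-- A lower bound of the difference quotient of the rate along `sharedCovariance`. -/
lemma mul_slope_le_log_sub_log {x y m ε : ℝ} (hx : 0 ≤ x) (hy : 0 ≤ y) (hm : 0 ≤ m)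
    (h0 : 0 ≤ ε) (h1 : ε ≤ 1) :
    ε * ((y - x + (1 - ε) * m) / (1 + (1 - ε) * x + ε * y + ε * (1 - ε) * m)) ≤
      Real.log (1 + (1 - ε) * x + ε * y + ε * (1 - ε) * m) - Real.log (1 + x) := by
  have h1' : 0 ≤ 1 - ε := by linarith
  have hq : 0 < 1 + (1 - ε) * x + ε * y + ε * (1 - ε) * m := by positivity
  have hx1 : 0 < 1 + x := by linarith
  -- The bound `1 - 1/s ≤ log s` at the ratio of the two determinants gives a rational lower bound
  -- in place of a derivative under the integral.
  have h := Real.one_sub_inv_le_log_of_pos (div_pos hq hx1)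
  rw [Real.log_div hq.ne' hx1.ne', inv_div] at h
  refine le_trans (le_of_eq ?_) h
  rw [eq_sub_iff_add_eq, mul_div_assoc', ← add_div, div_eq_one_iff_eq hq.ne']
  ring

/-- An envelope independent of `ε`, for dominated convergence. The product term `m ≤ x * y` is
harmless because the denominator is at least `1 + (1 - ε) x`. -/
lemma abs_slope_le {x y m ε : ℝ} (hx : 0 ≤ x) (hy : 0 ≤ y) (hm : 0 ≤ m) (hmxy : m ≤ x * y)
    (h0 : 0 ≤ ε) (h1 : ε ≤ 1) :
    |(y - x + (1 - ε) * m) / (1 + (1 - ε) * x + ε * y + ε * (1 - ε) * m)| ≤ x + 2 * y := by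
  have h1' : 0 ≤ 1 - ε := by linarith
  have hq : 1 ≤ 1 + (1 - ε) * x + ε * y + ε * (1 - ε) * m := by
    have : 0 ≤ (1 - ε) * x + ε * y + ε * (1 - ε) * m := by positivity
    linarith
  have hq' : 1 + (1 - ε) * x ≤ 1 + (1 - ε) * x + ε * y + ε * (1 - ε) * m := by
    have : 0 ≤ ε * y + ε * (1 - ε) * m := by positivity
    linarith
  set q := 1 + (1 - ε) * x + ε * y + ε * (1 - ε) * m
  have hq0 : 0 < q := by linarith
  have h2 : (1 - ε) * m ≤ q * y := by
    calc (1 - ε) * m ≤ (1 - ε) * (x * y) := mul_le_mul_of_nonneg_left hmxy h1'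
      _ ≤ (1 + (1 - ε) * x) * y := by nlinarith
      _ ≤ q * y := mul_le_mul_of_nonneg_right hq' hy
  have h3 : 0 ≤ (1 - ε) * m := by positivity
  have h4 : x + y ≤ q * (x + y) := le_mul_of_one_le_left (by positivity) hq
  rw [abs_div, abs_of_pos hq0, div_le_iff₀ hq0, abs_le]
  constructor <;> nlinarith

/-- The first order condition is necessary for the optimality of beamforming. -/
lemma le_of_isOptimalCovariance {γ : ℝ} (hγ : 0 ≤ γ) {ρ : Fin r → ℝ} {τ : Fin t → ℝ}
    (hρ : ∀ i, 0 < ρ i) (hτ : ∀ k, 0 ≤ τ k) {z o : Fin t} (hoz : o ≠ z)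
    (h : IsOptimalCovariance γ (kroneckerRayleigh (Matrix.diagonal fun i => (ρ i : ℂ))
      (Matrix.diagonal fun k => (τ k : ℂ))) (Matrix.single z z 1)) :
    γ * τ o * ∑ i, ρ i * (1 - ρ i * beamMean (γ * τ z) ρ z i) ≤
      ∑ i, ρ i * beamMean (γ * τ z) ρ z i := by
  let x : Matrix (Fin r) (Fin t) ℂ → ℝ := fun G => γ * normSqSum fun m => channel ρ τ G m z
  let y : Matrix (Fin r) (Fin t) ℂ → ℝ := fun G => γ * normSqSum fun m => channel ρ τ G m o
  let c : Matrix (Fin r) (Fin t) ℂ → ℝ := fun G =>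
    ‖star (fun m => channel ρ τ G m z) ⬝ᵥ (fun m => channel ρ τ G m o)‖ ^ 2
  -- `w` is `γ²` times the Gram determinant of the two columns, nonnegative by Cauchy–Schwarz. With
  -- it, `q ε` is the determinant at `sharedCovariance z o ε`, and `D ε` bounds the difference
  -- quotient of its logarithm from below.
  let w : Matrix (Fin r) (Fin t) ℂ → ℝ := fun G => x G * y G - γ ^ 2 * c G
  let q : ℝ → Matrix (Fin r) (Fin t) ℂ → ℝ := fun ε G =>
    1 + (1 - ε) * x G + ε * y G + ε * (1 - ε) * w G
  let D : ℝ → Matrix (Fin r) (Fin t) ℂ → ℝ := fun ε G => (y G - x G + (1 - ε) * w G) / q ε G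
  have hx0 : ∀ G, 0 ≤ x G := fun G => mul_nonneg hγ (normSqSum_nonneg _)
  have hy0 : ∀ G, 0 ≤ y G := fun G => mul_nonneg hγ (normSqSum_nonneg _)
  have hw0 : ∀ G, 0 ≤ w G := fun G => by
    have h1 := mul_le_mul_of_nonneg_left (norm_star_dotProduct_sq_le
      (fun m => channel ρ τ G m z) (fun m => channel ρ τ G m o)) (sq_nonneg γ)
    simp only [w, x, y, c]
    linarith
  have hwxy : ∀ G, w G ≤ x G * y G := fun G => by
    have : 0 ≤ γ ^ 2 * c G := by positivity
    simp only [w]; linarith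
  have hxc : Continuous x :=
    ((continuous_normSqSum_column z).comp (continuous_channel ρ τ)).const_mul γ
  have hyc : Continuous y :=
    ((continuous_normSqSum_column o).comp (continuous_channel ρ τ)).const_mul γ
  have hcc : Continuous c := by
    have h1 : Continuous fun H : Matrix (Fin r) (Fin t) ℂ =>
        star (fun m => H m z) ⬝ᵥ (fun m => H m o) :=
      continuous_finsetSum _ fun m _ => (continuous_entry m z).star.mul (continuous_entry m o)
    exact (h1.comp (continuous_channel ρ τ)).norm.pow 2
  have hwc : Continuous w := (hxc.mul hyc).sub (hcc.const_mul _)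
  have hqc : ∀ ε, Continuous (q ε) := fun ε => by
    simp only [q]; fun_prop
  have hDm : ∀ ε, Measurable (D ε) := fun ε => by
    have h1 := (hqc ε).measurable
    have h2 : Continuous fun G => y G - x G + (1 - ε) * w G := by fun_prop
    exact h2.measurable.div h1
  have hxi : Integrable x (stdGaussianMatrix r t) :=
    (integrable_normSqSum_channel hρ hτ z).const_mul γ
  have hyi : Integrable y (stdGaussianMatrix r t) :=
    (integrable_normSqSum_channel hρ hτ o).const_mul γ
  have hbi : Integrable (fun G => x G + 2 * y G) (stdGaussianMatrix r t) := hxi.add (hyi.const_mul 2)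
  have hDb : ∀ ε, 0 ≤ ε → ε ≤ 1 → ∀ G, ‖D ε G‖ ≤ x G + 2 * y G := fun ε h0 h1 G =>
    abs_slope_le (hx0 G) (hy0 G) (hw0 G) (hwxy G) h0 h1
  have hDi : ∀ ε, 0 ≤ ε → ε ≤ 1 → Integrable (D ε) (stdGaussianMatrix r t) := fun ε h0 h1 =>
    hbi.mono' (hDm ε).aestronglyMeasurable (.of_forall (hDb ε h0 h1))
  have hle : ∀ ε, 0 < ε → ε ≤ 1 → ∫ G, D ε G ∂stdGaussianMatrix r t ≤ 0 := by
    intro ε h0 h1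
    have hmem := sharedCovariance_mem h0.le h1 z o
    have h2 := h.2 hmem
    simp only [Set.mem_ofPred_eq, ergodicRate_kroneckerRayleigh hρ hτ] at h2
    have hi1 := integrable_log_det_rate hγ hρ hτ z hmem.1
    have hi2 := integrable_log_det_beam hγ hρ hτ z
    have h3 := integral_mono ((hDi ε h0.le h1).const_mul ε) (hi1.sub hi2) fun G => by
      have h4 := mul_slope_le_log_sub_log (hx0 G) (hy0 G) (hw0 G) h0.le h1
      refine h4.trans (le_of_eq ?_)
      simp only [Pi.sub_apply]
      rw [re_det_sharedCovariance, re_det_beam]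
      congr 2
      simp only [w, x, y, c]
      ring
    have h5 := integral_sub hi1 hi2
    rw [integral_const_mul] at h3
    have h6 : ε * ∫ G, D ε G ∂stdGaussianMatrix r t ≤ 0 := by
      refine h3.trans (h5.trans_le ?_)
      linarith
    by_contra! hpos
    exact absurd h6 (not_le.2 (mul_pos h0 hpos))
  have hlim : Filter.Tendsto (fun ε => ∫ G, D ε G ∂stdGaussianMatrix r t)
      (nhdsWithin 0 (Set.Ioi 0)) (nhds (∫ G, D 0 G ∂stdGaussianMatrix r t)) := by
    refine tendsto_integral_filter_of_dominated_convergence (fun G => x G + 2 * y G)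
      (.of_forall fun ε => (hDm ε).aestronglyMeasurable) ?_ hbi (.of_forall fun G => ?_)
    · filter_upwards [Ioc_mem_nhdsGT (zero_lt_one' ℝ)] with ε hε
      exact .of_forall (hDb ε hε.1.le hε.2)
    · have hq0 : q 0 G ≠ 0 := by
        have := hx0 G
        simp only [q]
        norm_num
        positivity
      have hcont : ContinuousAt (fun ε => D ε G) 0 := by
        refine ContinuousAt.div ?_ ?_ hq0
        · fun_prop
        · simp only [q]; fun_prop
      exact hcont.tendsto.mono_left nhdsWithin_le_nhds
  have h0 : ∫ G, D 0 G ∂stdGaussianMatrix r t ≤ 0 := by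
    refine le_of_tendsto hlim ?_
    filter_upwards [Ioc_mem_nhdsGT (zero_lt_one' ℝ)] with ε hε using hle ε hε.1 hε.2
  -- At `ε = 0` the lower bound equals the tangent increment from the beam `z` to the beam `o`, so
  -- its mean is the difference of two gradient entries.
  have hD0 : ∀ G, D 0 G = (γ * (∑ k, ∑ l, Matrix.single o o (1 : ℂ) k l *
      beamPair γ (channel ρ τ G) z k l - beamPair γ (channel ρ τ G) z z z)).re := fun G => by
    have h1 : ∑ k, ∑ l, Matrix.single o o (1 : ℂ) k l * beamPair γ (channel ρ τ G) z k l =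
        beamPair γ (channel ρ τ G) z o o := by
      simp [Matrix.single_apply, ite_and]
    have hx1 : 1 + x G ≠ 0 := by have := hx0 G; positivity
    rw [h1, beamPair_eq, beamPair_self hγ, ← Complex.ofReal_sub, ← Complex.ofReal_mul,
      Complex.ofReal_re]
    simp only [D, q, w, x, y, c, sub_zero, one_mul, zero_mul, add_zero] at hx1 ⊢
    generalize (normSqSum fun m => channel ρ τ G m z) = s at hx1 ⊢
    generalize (normSqSum fun m => channel ρ τ G m o) = s'
    field_simp
    ring
  simp_rw [hD0] at h0
  rw [integral_linearisation hγ hρ hτ, re_mul_integral_beamPair_beam hγ hρ hτ,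
    Finset.sum_eq_single o (fun k _ hk => by simp [hk.symm])
      (fun hh => absurd (Finset.mem_univ o) hh),
    re_mul_integral_beamPair_of_ne hγ hρ hτ hoz] at h0
  simp at h0
  linarith

end

end MIMO

end

/-! ### From the first-order condition to the explicit inequality. -/

theorem mainTheorem11 (r t : ℕ) (ht : 2 ≤ t) (γ : ℝ) (hγ : 0 < γ)
    (ρ : Fin r → ℝ) (τ : Fin t → ℝ)
    (hρ_pos : ∀ i, 0 < ρ i) (hρ_inj : Function.Injective ρ)
    (hρ_trace : ∑ i, ρ i = (r : ℝ))
    (hτ_nonneg : ∀ k, 0 ≤ τ k) (hτ_trace : ∑ k, τ k = (t : ℝ))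
    (hτ_first : 0 < τ ⟨0, by omega⟩)
    (hτ_second : ∀ k : Fin t, k ≠ ⟨0, by omega⟩ → τ k ≤ τ ⟨1, by omega⟩) :
    MIMO.IsOptimalCovariance γ
        (MIMO.kroneckerRayleigh (Matrix.diagonal fun i => (ρ i : ℂ))
          (Matrix.diagonal fun k => (τ k : ℂ)))
        (Matrix.single ⟨0, by omega⟩ ⟨0, by omega⟩ (1 : ℂ)) ↔
      (r : ℝ) * γ * τ ⟨1, by omega⟩ ≤
        ∑ i, ∑ j,
          ρ i * (1 + γ * τ ⟨1, by omega⟩ * ρ i) * ρ j ^ (r - 1) /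
              (∏ k ∈ Finset.univ.erase j, (ρ j - ρ k)) *
            MIMO.beamZeta (γ * τ ⟨0, by omega⟩) ρ i j := by
  have hz : 0 < t := by omega
  have ho : 1 < t := by omega
  have ha : 0 < γ * τ ⟨0, hz⟩ := mul_pos hγ hτ_first
  have hfirst : MIMO.IsOptimalCovariance γ
      (MIMO.kroneckerRayleigh (Matrix.diagonal fun i => (ρ i : ℂ))
        (Matrix.diagonal fun k => (τ k : ℂ))) (Matrix.single ⟨0, hz⟩ ⟨0, hz⟩ (1 : ℂ)) ↔
      γ * τ ⟨1, ho⟩ * ∑ i, ρ i * (1 - ρ i * MIMO.beamMean (γ * τ ⟨0, hz⟩) ρ ⟨0, hz⟩ i) ≤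
        ∑ i, ρ i * MIMO.beamMean (γ * τ ⟨0, hz⟩) ρ ⟨0, hz⟩ i :=
    ⟨MIMO.le_of_isOptimalCovariance hγ.le hρ_pos hτ_nonneg (by simp),
      MIMO.isOptimalCovariance_of_le hγ.le hρ_pos hτ_nonneg hτ_second⟩
  have hsum : ∑ i, ∑ j, ρ i * (1 + γ * τ ⟨1, ho⟩ * ρ i) * ρ j ^ (r - 1) /
        (∏ k ∈ Finset.univ.erase j, (ρ j - ρ k)) * MIMO.beamZeta (γ * τ ⟨0, hz⟩) ρ i j =
      ∑ i, ρ i * (1 + γ * τ ⟨1, ho⟩ * ρ i) *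
        MIMO.beamMean (γ * τ ⟨0, hz⟩) ρ ⟨0, hz⟩ i := by
    refine Finset.sum_congr rfl fun i _ => ?_
    rw [MIMO.beamMean_eq_sum_beamZeta ha hρ_pos hρ_inj, Finset.mul_sum]
    exact Finset.sum_congr rfl fun j _ => by ring
  -- The sum is the slack of the first-order condition plus `γ τ₂ ∑ ρ_i`; since `∑ ρ_i = r`, the
  -- last term is the threshold `r γ τ₂`.
  have hsplit : ∑ i, ρ i * (1 + γ * τ ⟨1, ho⟩ * ρ i) *
        MIMO.beamMean (γ * τ ⟨0, hz⟩) ρ ⟨0, hz⟩ i =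
      (∑ i, ρ i * MIMO.beamMean (γ * τ ⟨0, hz⟩) ρ ⟨0, hz⟩ i) -
        γ * τ ⟨1, ho⟩ *
          (∑ i, ρ i * (1 - ρ i * MIMO.beamMean (γ * τ ⟨0, hz⟩) ρ ⟨0, hz⟩ i)) +
        γ * τ ⟨1, ho⟩ * ∑ i, ρ i := by
    rw [Finset.mul_sum, Finset.mul_sum, ← Finset.sum_sub_distrib, ← Finset.sum_add_distrib]
    exact Finset.sum_congr rfl fun i _ => by ring
  refine hfirst.trans ?_
  rw [hsum, hsplit, hρ_trace]
  constructor <;> intro h <;> linarith
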